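/- **Conventions.** A simplicial complex is a pair $(V,S)$ of a vertex set and a set $S$ of non-empty finite subsets of $V$ (simplices) that contains all singletons and is closed under non-empty subsets; a simplicial map is a map of vertices that carries simplices to simplices. The geometric realization $|K|$ is the set of formal sums $\sum_i t_iv_i\in\mathbb R^V$ with $t_i\ge 0$, $\sum_i t_i=1$, $\{v_0,\dots,v_n\}\in S$, with the union topology (a set is open iff its intersection with each closed geometric simplex is open in that simplex). For a simplicial map $f$, $|f|$ denotes its linear extension. A subdivision of $K$ is a complex $K'$ whose vertices are points of $|K|$ and such that the linear extension $|K'|\to|K|$ is a homeomorphism. The mesh size of $K'$ is the supremum of the diameters, in the standard Euclidean metric of $|K|$ (vertices orthonormal), of the images of the geometric simplices of $K'$. A simplicial map $f\colon K\to L$ is a simplicial approximation of a continuous map $\phi\colon|K|\to|L|$ if, whenever $\phi(x)$ lies in the open simplex of $\sigma$, $|f|(x)$ lies in the closed simplex $|\sigma|$. The contiguity complex $\mathrm{Map}_{SC}(K,L)$ has as vertices the simplicial maps $K\to L$ and as simplices the non-empty finite sets $\{f_0,\dots,f_n\}$ such that $\{f_i(v_j)\}_{i,j}$ is a simplex of $L$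 for each simplex $\{v_0,\dots,v_m\}$ of $K$. $\mathrm{Map}_{Top}$ denotes the space of continuous maps with the compact-open topology. The comparison map $\Gamma\colon|\mathrm{Map}_{SC}(K,L)|\to\mathrm{Map}_{Top}(|K|,|L|)$ is $\Gamma(\sum_i t_if_i)(\sum_j s_jv_j)=\sum_{i,j}t_is_jf_i(v_j)$. **Setting.** Let $X$ be a finite simplicial complex and $Y$ any simplicial complex. Let $X_0=X$, and for each $n\ge 0$ let $X_{n+1}$ be a subdivision of $X_n$, with homeomorphism $h_n\colon|X_{n+1}|\cong|X_n|$, and let $f_n\colon X_{n+1}\to X_n$ be a simplicial approximation of $h_n$. Assume that the mesh size of $X_n$, as a subdivision of $X$, tends to $0$. Put $A_n=|\mathrm{Map}_{SC}(X_n,Y)|$ and $\phi_n=|f_n^*|\colon A_n\to A_{n+1}$, where $f_n^*(g)=g\circ f_n$. Let $F$ be the telescope of $(\phi_n)$: the quotient of $\coprod_n A_n\times[0,1]$ that identifies $(a,1)\in A_n\times[0,1]$ with $(\phi_n(a),0)\in A_{n+1}\times[0,1]$. Let $\Phi\colon F\to\mathrm{Map}_{Top}(|X|,|Y|)$ be the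 continuous map which on $A_n\times[0,1]$ is $$(a,t)\mapsto (1-t)\,\Gamma(a)+t\,\Gamma(a)\circ|f_n|\circ h_n^{-1}\in \mathrm{Map}_{Top}(|X_n|,|Y|)\cong\mathrm{Map}_{Top}(|X|,|Y|),$$ the last homeomorphism being induced by $|X_n|\cong|X|$. **Theorem.** 1. $\Phi$ is a weak homotopy equivalence: it induces a bijection on path components and, for every $x\in F$ and $q\ge1$, an isomorphism $\pi_q(F,x)\to\pi_q(\mathrm{Map}_{Top}(|X|,|Y|),\Phi(x))$. 2. In particular, $\Phi$ is a bijection on path components. 3. Let $k\ge 0$, $q\ge1$, let $g\colon X_k\to Y$ be a simplicial map, and for $n\ge k$ let $f^n_k=f_k\circ\cdots\circ f_{n-1}\colon X_n\to X_k$ (the identity for $n=k$) and $h^n_k\colon|X_n|\cong|X_k|$ be the composites. The map $$\operatorname{colim}_{n\ge k}\pi_q(|\mathrm{Map}_{SC}(X_n,Y)|,\,g\circ f^n_k)\to\pi_q(\mathrm{Map}_{Top}(|X_k|,|Y|),|g|)$$ is well defined and bijective. Here the colimit is taken along the maps induced by the $\phi_n$, and the map is induced by $\Gamma$ and $|X_n|\cong|X_k|$,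 followed by the change of base point along the path $t\mapsto t\,|g|+(1-t)\,|g\circ f^n_k|\circ (h^n_k)^{-1}$ from $|g\circ f^n_k|\circ(h^n_k)^{-1}$ to $|g|$. -/

import Mathlib

open scoped Topology Topology.Homotopy

universe u v w

noncomputable section

namespace ContiguityComplex



/-! ### Simplicial complexes and geometric realization -/

/-- A map of simplicial complexes: a map of vertices carrying simplices to simplices. -/
@[ext]
structure SimplicialMap {V : Type u} {W : Type v} (K : AbstractSimplicialComplex V)
    (L : AbstractSimplicialComplex W) where
  /-- the map on vertices -/
  toFun : V → W
  map_mem : open Classical in ∀ σ ∈ K, σ.image toFun ∈ L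

/-- Composition of simplicial maps. -/
def SimplicialMap.comp {V : Type u} {W : Type v} {Z : Type w} {K : AbstractSimplicialComplex V}
    {L : AbstractSimplicialComplex W} {M : AbstractSimplicialComplex Z}
    (g : SimplicialMap L M) (f : SimplicialMap K L) : SimplicialMap K M where
  toFun := g.toFun ∘ f.toFun
  map_mem σ hσ := by
    classical
    have := g.map_mem _ (f.map_mem σ hσ)
    rwa [Finset.image_image] at this

/-- The identity simplicial map. -/
def SimplicialMap.id {V : Type u} (K : AbstractSimplicialComplex V) : SimplicialMap K K where
  toFun := _root_.id
  map_mem σ hσ := by simpa using hσ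

/-- The geometric realization `|K|`: the points `t₀ v₀ + ⋯ + tₙ vₙ` of the real vector space with
basis `V`, where `tᵢ ≥ 0`, `∑ tᵢ = 1` and `{v₀, …, vₙ}` is a simplex. (As simplices are closed under
nonempty subsets, this says that the support of the point is a simplex.) -/
@[ext]
structure Realization {V : Type u} (K : AbstractSimplicialComplex V) : Type u where
  /-- the barycentric coordinates -/
  coord : V →₀ ℝ
  nonneg : ∀ v, 0 ≤ coord v
  sum_eq_one : (coord.sum fun _ t => t) = 1
  support_mem : coord.support ∈ K

/-- The closed geometric simplex `|σ| ⊆ |K|`. -/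
def closedSimplex {V : Type u} (K : AbstractSimplicialComplex V) (σ : Finset V) :
    Set (Realization K) :=
  {x | x.coord.support ⊆ σ}

/-- The open simplex of `σ` in `|K|`: all barycentric coordinates indexed by `σ` are nonzero, and
no others. -/
def openSimplex {V : Type u} (K : AbstractSimplicialComplex V) (σ : Finset V) :
    Set (Realization K) :=
  {x | x.coord.support = σ}

/-- The geometric simplex `|σ|` as a space in its own right, with its inclusion `pt` into `|K|`. -/
@[ext]
structure Cell {V : Type u} (K : AbstractSimplicialComplex V) (σ : Finset V) : Type u where
  /-- the underlying point of `|K|` -/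
  pt : Realization K
  mem : pt ∈ closedSimplex K σ

/-- The geometric simplex `|σ|` has the standard (Euclidean) topology, that is, the topology of
convergence of the finitely many barycentric coordinates. -/
instance {V : Type u} (K : AbstractSimplicialComplex V) (σ : Finset V) :
    TopologicalSpace (Cell K σ) :=
  TopologicalSpace.induced (fun x (v : V) => x.pt.coord v) inferInstance

/-- The union topology on `|K|`: a set is open if and only if its intersection with every geometric
simplex is open in that simplex. -/
instance {V : Type u} (K : AbstractSimplicialComplex V) : TopologicalSpace (Realization K) :=
  ⨆ σ : {σ : Finset V // σ ∈ K}, TopologicalSpace.coinduced (Cell.pt (σ := σ.1)) inferInstance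

section Topology

variable {V : Type u} {W : Type v} {Z : Type w} {K : AbstractSimplicialComplex V}
  {L : AbstractSimplicialComplex W} {M : AbstractSimplicialComplex Z}

theorem isOpen_iff {U : Set (Realization K)} :
    IsOpen U ↔ ∀ σ ∈ K, IsOpen (Cell.pt (σ := σ) ⁻¹' U) := by
  simp only [isOpen_iSup_iff, isOpen_coinduced, Subtype.forall]

theorem continuous_dom {T : Type*} [TopologicalSpace T] {f : Realization K → T}
    (h : ∀ σ ∈ K, Continuous fun x : Cell K σ => f x.pt) : Continuous f := by
  rw [continuous_iSup_dom]
  rintro ⟨σ, hσ⟩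
  rw [continuous_coinduced_dom]
  exact h σ hσ

theorem continuous_pt {σ : Finset V} (hσ : σ ∈ K) : Continuous (Cell.pt : Cell K σ → _) := by
  refine continuous_def.2 fun U hU => ?_
  exact isOpen_iff.1 hU σ hσ

theorem continuous_coord {σ : Finset V} (v : V) : Continuous fun x : Cell K σ => x.pt.coord v :=
  (continuous_apply v).comp (continuous_induced_dom (f := fun (x : Cell K σ) (v : V) => x.pt.coord v))

theorem continuous_cod {T : Type*} [TopologicalSpace T] {f : T → Realization K} {σ : Finset V}
    (hσ : σ ∈ K) (hf : ∀ t, (f t).coord.support ⊆ σ) (hc : ∀ v, Continuous fun t => (f t).coord v) :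
    Continuous f := by
  let g : T → Cell K σ := fun t => ⟨f t, hf t⟩
  have hg : Continuous g := continuous_induced_rng.2 (continuous_pi hc)
  exact (continuous_pt hσ).comp hg

theorem coord_le_one (x : Realization K) (v : V) : x.coord v ≤ 1 := by
  by_cases hv : v ∈ x.coord.support
  · rw [← x.sum_eq_one]
    exact Finset.single_le_sum (f := fun v => x.coord v) (fun i _ => x.nonneg i) hv
  · rw [Finsupp.notMem_support_iff.1 hv]; exact zero_le_one

theorem eq_of_coord {x y : Realization K} (h : ∀ v, x.coord v = y.coord v) : x = y :=
  Realization.ext (Finsupp.ext h)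

theorem mem_of_subset {σ τ : Finset V} (hτ : τ ∈ K) (h : σ ⊆ τ) (hσ : σ.Nonempty) : σ ∈ K :=
  (K.isRelLowerSet_faces hτ).2 h hσ

theorem nonempty_of_mem {σ : Finset V} (hσ : σ ∈ K) : σ.Nonempty :=
  (K.isRelLowerSet_faces hσ).1

theorem isEmbedding_coord {σ : Finset V} :
    Topology.IsEmbedding fun (x : Cell K σ) (v : V) => x.pt.coord v :=
  ⟨⟨rfl⟩, fun _ _ h => Cell.ext (eq_of_coord fun v => congrFun h v)⟩

theorem locallyCompactSpace_cell {σ : Finset V} (hσ : σ ∈ K) : LocallyCompactSpace (Cell K σ) := by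
  classical
  have hr : Set.range (fun (x : Cell K σ) (v : V) => x.pt.coord v) =
      {y | (∀ v, 0 ≤ y v) ∧ (∑ v ∈ σ, y v) = 1 ∧ ∀ v, v ∉ σ → y v = 0} := by
    ext y
    constructor
    · rintro ⟨x, rfl⟩
      refine ⟨x.pt.nonneg, ?_, fun v hv => ?_⟩
      · rw [← x.pt.sum_eq_one]
        exact (Finsupp.sum_of_support_subset x.pt.coord x.mem (fun _ t => t) fun _ _ => rfl).symm
      · exact Finsupp.notMem_support_iff.1 fun h => hv (x.mem h)
    · rintro ⟨h0, h1, h2⟩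
      let z : V →₀ ℝ := Finsupp.onFinset σ y fun v hv => by
        by_contra h
        exact hv (h2 v h)
      have hz : z.support ⊆ σ := Finsupp.support_onFinset_subset
      have hs : (z.sum fun _ t => t) = 1 := by
        rw [Finsupp.sum_of_support_subset _ hz _ fun _ _ => rfl]
        exact h1
      have hn : z.support.Nonempty := by
        rw [Finset.nonempty_iff_ne_empty]
        intro h
        rw [Finsupp.sum, h] at hs
        simp at hs
      exact ⟨⟨⟨z, h0, hs, mem_of_subset hσ hz hn⟩, hz⟩, rfl⟩
  have hclosed : IsClosed (Set.range (fun (x : Cell K σ) (v : V) => x.pt.coord v)) := by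
    rw [hr]
    simp only [Set.ofPred_and, Set.ofPred_forall]
    refine IsClosed.inter ?_ (IsClosed.inter ?_ ?_)
    · exact isClosed_iInter fun v => isClosed_le continuous_const (continuous_apply v)
    · exact isClosed_eq (by fun_prop) continuous_const
    · exact isClosed_iInter fun v => isClosed_iInter fun _ =>
        isClosed_eq (continuous_apply v) continuous_const
  have hsub : Set.range (fun (x : Cell K σ) (v : V) => x.pt.coord v) ⊆
      Set.univ.pi fun _ => Set.Icc (0 : ℝ) 1 := by
    rintro _ ⟨x, rfl⟩ v _
    exact ⟨x.pt.nonneg v, coord_le_one _ v⟩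
  have hcomp := (isCompact_univ_pi fun _ : V => isCompact_Icc (a := (0 : ℝ)) (b := 1)).of_isClosed_subset
    hclosed hsub
  have : CompactSpace (Cell K σ) := by
    rw [← isCompact_univ_iff, isEmbedding_coord.isCompact_iff, Set.image_univ]
    exact hcomp
  have : T2Space (Cell K σ) := isEmbedding_coord.t2Space
  infer_instance

/-- A family of maps `|K| → |L|` indexed by `|M| × P` is continuous for the compact-open topology
if, on each product of geometric simplices, it lands in a geometric simplex and has continuous
barycentric coordinates. -/
theorem exists_continuous_family {P : Type*} [TopologicalSpace P] [LocallyCompactSpace P]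
    (F : Realization M → P → Realization K → Realization L)
    (hF : ∀ s ∈ M, ∀ σ ∈ K, (∃ τ ∈ L, ∀ (a : Cell M s) (t : P) (z : Cell K σ),
        (F a.pt t z.pt).coord.support ⊆ τ) ∧
      ∀ w, Continuous fun q : (Cell M s × P) × Cell K σ => (F q.1.1.pt q.1.2 q.2.pt).coord w) :
    ∃ G : C(Realization M × P, C(Realization K, Realization L)), ∀ a t z, G (a, t) z = F a t z := by
  have h1 : ∀ s ∈ M, ∀ σ ∈ K,
      Continuous fun q : (Cell M s × P) × Cell K σ => F q.1.1.pt q.1.2 q.2.pt := by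
    intro s hs σ hσ
    obtain ⟨⟨τ, hτ, h⟩, hc⟩ := hF s hs σ hσ
    exact continuous_cod hτ (fun q => h _ _ _) hc
  have h2 : ∀ s ∈ M, Continuous fun q : Realization K × (Cell M s × P) =>
      F q.2.1.pt q.2.2 q.1 := by
    intro s hs
    have := locallyCompactSpace_cell hs
    let f : Realization K → C(Cell M s × P, Realization L) := fun z =>
      ⟨fun q => F q.1.pt q.2 z, (h1 s hs _ z.support_mem).comp
        (continuous_id.prodMk (continuous_const (y := (⟨z, Finset.Subset.refl _⟩ : Cell K z.coord.support))))⟩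
    have hf : Continuous f := continuous_dom fun σ hσ => by
      refine ContinuousMap.continuous_of_continuous_uncurry _ ?_
      exact (h1 s hs σ hσ).comp continuous_swap
    exact ContinuousMap.continuous_uncurry_of_continuous ⟨f, hf⟩
  have h3 : ∀ s (_ : s ∈ M) (q : Cell M s × P), Continuous (F q.1.pt q.2) := fun s hs q =>
    (h2 s hs).comp (continuous_id.prodMk continuous_const)
  let g : Realization M → P → C(Realization K, Realization L) := fun a t =>
    ⟨F a t, h3 _ a.support_mem (⟨a, Finset.Subset.refl _⟩, t)⟩
  have h4 : ∀ s ∈ M, Continuous fun q : Cell M s × P => g q.1.pt q.2 := fun s hs => by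
    refine ContinuousMap.continuous_of_continuous_uncurry _ ?_
    exact (h2 s hs).comp continuous_swap
  let f : Realization M → C(P, C(Realization K, Realization L)) := fun a =>
    ⟨g a, (h4 _ a.support_mem).comp
      ((continuous_const (y := (⟨a, Finset.Subset.refl _⟩ : Cell M a.coord.support))).prodMk continuous_id)⟩
  have hf : Continuous f := continuous_dom fun s hs => by
    refine ContinuousMap.continuous_of_continuous_uncurry _ ?_
    exact h4 s hs
  exact ⟨⟨fun q => f q.1 q.2, ContinuousMap.continuous_uncurry_of_continuous ⟨f, hf⟩⟩,
    fun _ _ _ => rfl⟩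

theorem continuous_family {P : Type*} [TopologicalSpace P] [LocallyCompactSpace P]
    (F : Realization M → P → C(Realization K, Realization L))
    (hF : ∀ s ∈ M, ∀ σ ∈ K, (∃ τ ∈ L, ∀ (a : Cell M s) (t : P) (z : Cell K σ),
        (F a.pt t z.pt).coord.support ⊆ τ) ∧
      ∀ w, Continuous fun q : (Cell M s × P) × Cell K σ => (F q.1.1.pt q.1.2 q.2.pt).coord w) :
    Continuous fun q : Realization M × P => F q.1 q.2 := by
  obtain ⟨G, hG⟩ := exists_continuous_family (fun a t z => F a t z) hF
  have : (fun q : Realization M × P => F q.1 q.2) = G := by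
    funext q
    exact ContinuousMap.ext fun z => (hG q.1 q.2 z).symm
  rw [this]
  exact G.continuous

theorem continuous_coordinate (v : V) : Continuous fun x : Realization K => x.coord v :=
  continuous_dom fun _ _ => continuous_coord v

end Topology

/-- A finitely supported function with nonnegative values of sum `1` whose support is contained in a
simplex, as a point of the realization. -/
def Realization.ofSubset {V : Type u} {K : AbstractSimplicialComplex V} (x : V →₀ ℝ)
    (h0 : ∀ v, 0 ≤ x v) (h1 : (x.sum fun _ t => t) = 1) (h2 : ∃ τ ∈ K, x.support ⊆ τ) :
    Realization K where
  coord := x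
  nonneg := h0
  sum_eq_one := h1
  support_mem := by
    obtain ⟨τ, hτ, h⟩ := h2
    refine mem_of_subset hτ h ?_
    rw [Finset.nonempty_iff_ne_empty]
    intro he
    rw [Finsupp.sum, he] at h1
    simp at h1

/-- The vertex `v` as a point of the realization. -/
def Realization.vertex {V : Type u} (K : AbstractSimplicialComplex V) (v : V) : Realization K :=
  .ofSubset (Finsupp.single v 1)
    (fun w => by classical rw [Finsupp.single_apply]; split_ifs <;> norm_num)
    (by simp) ⟨{v}, K.singleton_mem v, Finsupp.support_single_subset⟩

/-- The map on realizations induced by a simplicial map, as a function. -/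
def SimplicialMap.realFun {V : Type u} {W : Type v} {K : AbstractSimplicialComplex V}
    {L : AbstractSimplicialComplex W} (f : SimplicialMap K L) (x : Realization K) :
    Realization L :=
  .ofSubset (x.coord.mapDomain f.toFun)
    (fun w => by
      classical
      rw [Finsupp.mapDomain, Finsupp.sum, Finsupp.finsetSum_apply]
      refine Finset.sum_nonneg fun v _ => ?_
      rw [Finsupp.single_apply]
      split_ifs
      exacts [x.nonneg v, le_rfl])
    ((Finsupp.degree_mapDomain _ _).trans x.sum_eq_one)
    (by classical exact ⟨_, f.map_mem _ x.support_mem, Finsupp.mapDomain_support⟩)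

theorem SimplicialMap.realFun_coord {V : Type u} {W : Type v} {K : AbstractSimplicialComplex V}
    {L : AbstractSimplicialComplex W} (f : SimplicialMap K L) (x : Realization K) :
    (f.realFun x).coord = x.coord.mapDomain f.toFun := rfl

theorem SimplicialMap.continuous_realFun {V : Type u} {W : Type v}
    {K : AbstractSimplicialComplex V} {L : AbstractSimplicialComplex W} (f : SimplicialMap K L) :
    Continuous f.realFun := by
  classical
  refine continuous_dom fun σ hσ => ?_
  refine continuous_cod (f.map_mem σ hσ) (fun x => ?_) fun w => ?_
  · exact Finsupp.mapDomain_support.trans (Finset.image_subset_image x.mem)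
  · have : (fun x : Cell K σ => (f.realFun x.pt).coord w) =
        fun x : Cell K σ => ∑ v ∈ σ, if f.toFun v = w then x.pt.coord v else 0 := by
      funext x
      rw [f.realFun_coord, Finsupp.mapDomain,
        Finsupp.sum_of_support_subset _ x.mem _ (by simp), Finsupp.finsetSum_apply]
      simp only [Finsupp.single_apply]
    rw [this]
    refine continuous_finsetSum _ fun v _ => ?_
    split_ifs
    exacts [continuous_coord v, continuous_const]

/-- The continuous map `|f| : |K| → |L|` induced by a simplicial map `f`. It is the linear extension
of the map on vertices. -/
def SimplicialMap.real {V : Type u} {W : Type v} {K : AbstractSimplicialComplex V}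
    {L : AbstractSimplicialComplex W} (f : SimplicialMap K L) :
    C(Realization K, Realization L) :=
  ⟨f.realFun, f.continuous_realFun⟩

/-! ### Subdivision, mesh size and simplicial approximation -/

/-- `K'` is a subdivision of `K`: the vertices of `K'` are points of `|K|` (through `pos`), and the
linear extension of `pos` is a homeomorphism `|K'| ≅ |K|`. The map `pos` is injective as a
consequence. -/
structure Subdivision {V' : Type u} {V : Type v} (K' : AbstractSimplicialComplex V')
    (K : AbstractSimplicialComplex V) where
  /-- the point of `|K|` given by a vertex of `K'` -/
  pos : V' → Realization K
  /-- the subdivision homeomorphism -/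
  homeo : Realization K' ≃ₜ Realization K
  homeo_coord : ∀ z, (homeo z).coord = z.coord.sum fun v t => t • (pos v).coord

/-- The standard metric on `|K|`: the Euclidean one, for which the vertices are orthonormal. -/
def standardDist {V : Type u} {K : AbstractSimplicialComplex V} (x y : Realization K) : ℝ :=
  Real.sqrt ((x.coord - y.coord).sum fun _ t => t ^ 2)

/-- The mesh size of a subdivision `K'` of `K`: the supremum of the diameters in `|K|`, for the
standard metric, of the images of the geometric simplices of `|K'|`. -/
def Subdivision.mesh {V' : Type u} {V : Type v} {K' : AbstractSimplicialComplex V'}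
    {K : AbstractSimplicialComplex V} (S : Subdivision K' K) : ENNReal :=
  ⨆ σ ∈ K', ⨆ x ∈ closedSimplex K' σ, ⨆ y ∈ closedSimplex K' σ,
    ENNReal.ofReal (standardDist (S.homeo x) (S.homeo y))

/-- The simplicial map `f` is a simplicial approximation of the continuous map `φ`: whenever `φ x`
lies in the open simplex of `σ`, the point `|f| x` lies in the closed simplex `|σ|`. -/
def IsSimplicialApproximation {V : Type u} {W : Type v} {K : AbstractSimplicialComplex V}
    {L : AbstractSimplicialComplex W} (f : SimplicialMap K L)
    (φ : C(Realization K, Realization L)) : Prop :=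
  ∀ x, ∀ σ ∈ L, φ x ∈ openSimplex L σ → f.real x ∈ closedSimplex L σ

/-- The trivial subdivision. -/
def Subdivision.refl {V : Type u} (K : AbstractSimplicialComplex V) : Subdivision K K where
  pos := Realization.vertex K
  homeo := Homeomorph.refl _
  homeo_coord z := by
    simp [Realization.vertex, Realization.ofSubset]

/-- A subdivision of a subdivision of `K`, regarded as a subdivision of `K`. -/
def Subdivision.trans {V'' : Type u} {V' : Type v} {V : Type w}
    {K'' : AbstractSimplicialComplex V''} {K' : AbstractSimplicialComplex V'}
    {K : AbstractSimplicialComplex V} (S' : Subdivision K'' K') (S : Subdivision K' K) :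
    Subdivision K'' K where
  pos v := S.homeo (S'.pos v)
  homeo := S'.homeo.trans S.homeo
  homeo_coord z := by
    have h : ∀ z : Realization K', (S.homeo z).coord =
        Finsupp.linearCombination ℝ (fun v => (S.pos v).coord) z.coord := S.homeo_coord
    simp only [Homeomorph.trans_apply, h]
    rw [S'.homeo_coord, Finsupp.sum, map_sum]
    simp only [map_smul]
    rfl

theorem SimplicialMap.support_real {V : Type u} {W : Type v} {K : AbstractSimplicialComplex V}
    {L : AbstractSimplicialComplex W} (f : SimplicialMap K L) (x : Realization K) (w : W) :
    w ∈ (f.real x).coord.support ↔ ∃ v ∈ x.coord.support, f.toFun v = w := by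
  classical
  constructor
  · intro h
    simpa using Finsupp.mapDomain_support h
  · rintro ⟨v, hv, rfl⟩
    rw [Finsupp.mem_support_iff]
    have h0 : 0 < x.coord v :=
      lt_of_le_of_ne (x.nonneg v) (Ne.symm (Finsupp.mem_support_iff.1 hv))
    have h1 : x.coord v ≤ (f.real x).coord (f.toFun v) := by
      change _ ≤ x.coord.mapDomain f.toFun (f.toFun v)
      rw [Finsupp.mapDomain, Finsupp.sum, Finsupp.finsetSum_apply]
      have := Finset.single_le_sum
        (f := fun u => Finsupp.single (f.toFun u) (x.coord u) (f.toFun v)) (s := x.coord.support)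
        (fun u _ => by
          rw [Finsupp.single_apply]
          split_ifs
          exacts [x.nonneg u, le_rfl]) hv
      simpa using this
    exact (h0.trans_le h1).ne'

theorem IsSimplicialApproximation.comp {V'' : Type*} {V' : Type*} {V : Type*}
    {K'' : AbstractSimplicialComplex V''} {K' : AbstractSimplicialComplex V'}
    {K : AbstractSimplicialComplex V} {f : SimplicialMap K' K} {f' : SimplicialMap K'' K'}
    {φ : C(Realization K', Realization K)} {φ' : C(Realization K'', Realization K')}
    (h : IsSimplicialApproximation f φ) (h' : IsSimplicialApproximation f' φ') :
    IsSimplicialApproximation (f.comp f') (φ.comp φ') := by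
  intro x σ hσ hx w hw
  obtain ⟨v, hv, rfl⟩ := (SimplicialMap.support_real _ _ _).1 hw
  have h1 := h (φ' x) σ hσ hx
  have h2 := h' x _ (φ' x).support_mem rfl
  refine h1 ((SimplicialMap.support_real _ _ _).2 ⟨f'.toFun v, h2 ?_, rfl⟩)
  exact (SimplicialMap.support_real _ _ _).2 ⟨v, hv, rfl⟩

theorem isSimplicialApproximation_id {V : Type u} (K : AbstractSimplicialComplex V) :
    IsSimplicialApproximation (SimplicialMap.id K) (ContinuousMap.id _) := by
  intro x σ _ hx w hw
  obtain ⟨v, hv, rfl⟩ := (SimplicialMap.support_real _ _ _).1 hw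
  exact hx.subset hv

/-- A subdivision carries each geometric simplex into a geometric simplex. -/
theorem Subdivision.exists_cell {V' : Type u} {V : Type v} {K' : AbstractSimplicialComplex V'}
    {K : AbstractSimplicialComplex V} (S : Subdivision K' K) {σ : Finset V'} (hσ : σ ∈ K') :
    ∃ ρ ∈ K, ∀ z ∈ closedSimplex K' σ, S.homeo z ∈ closedSimplex K ρ := by
  classical
  have hcard : (0 : ℝ) < σ.card := by exact_mod_cast (nonempty_of_mem hσ).card_pos
  let b : V' →₀ ℝ := Finsupp.onFinset σ (fun v => if v ∈ σ then (σ.card : ℝ)⁻¹ else 0)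
    (fun v hv => by
      by_contra h
      exact hv (if_neg h))
  have hb : b.support ⊆ σ := Finsupp.support_onFinset_subset
  have hbv : ∀ v ∈ σ, b v = (σ.card : ℝ)⁻¹ := fun v hv => if_pos hv
  let z₀ : Realization K' := .ofSubset b
    (fun v => by
      change 0 ≤ if v ∈ σ then (σ.card : ℝ)⁻¹ else 0
      split_ifs <;> positivity)
    (by
      rw [Finsupp.sum_of_support_subset _ hb _ fun _ _ => rfl, Finset.sum_congr rfl hbv]
      simp [hcard.ne']) ⟨σ, hσ, hb⟩
  have hc : ∀ (z : Realization K'), z ∈ closedSimplex K' σ → ∀ v,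
      (S.homeo z).coord v = ∑ u ∈ σ, z.coord u * (S.pos u).coord v := by
    intro z hz v
    rw [S.homeo_coord, Finsupp.sum_of_support_subset _ hz _ (by simp), Finsupp.finsetSum_apply]
    simp
  refine ⟨_, (S.homeo z₀).support_mem, fun z hz v hv => ?_⟩
  rw [Finsupp.mem_support_iff, hc z hz v] at hv
  rw [Finsupp.mem_support_iff, hc z₀ hb v]
  obtain ⟨u, hu, hne⟩ := Finset.exists_ne_zero_of_sum_ne_zero hv
  refine (Finset.sum_pos' (fun i hi => mul_nonneg (z₀.nonneg i) ((S.pos i).nonneg v))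
    ⟨u, hu, ?_⟩).ne'
  refine mul_pos ?_ (lt_of_le_of_ne ((S.pos u).nonneg v) (Ne.symm (right_ne_zero_of_mul hne)))
  change 0 < b u
  rw [hbv u hu]
  positivity

/-! ### The contiguity complex and the comparison map -/

open Classical in
/-- The contiguity complex `Map_SC(K, L)`: its vertices are the simplicial maps `K → L`, and its
simplices are the nonempty finite sets `{f₀, …, fₙ}` of mutually contiguous maps, that is, such that
`{fᵢ(vⱼ)}` is a simplex of `L` for each simplex `{v₀, …, vₘ}` of `K`. -/
def contiguityComplex {V : Type u} {W : Type v} (K : AbstractSimplicialComplex V)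
    (L : AbstractSimplicialComplex W) : AbstractSimplicialComplex (SimplicialMap K L) where
  faces := {s | s.Nonempty ∧ ∀ σ ∈ K, Finset.image₂ (fun f v => f.toFun v) s σ ∈ L}
  isRelLowerSet_faces := by
    rintro s ⟨hs, h⟩
    refine ⟨hs, fun t hts ht => ⟨ht, fun σ hσ => ?_⟩⟩
    exact mem_of_subset (h σ hσ) (Finset.image₂_subset hts (Finset.Subset.refl _))
      (ht.image₂ (nonempty_of_mem hσ))
  singleton_mem f := by
    refine ⟨Finset.singleton_nonempty f, fun σ hσ => ?_⟩
    rw [Finset.image₂_singleton_left]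
    exact f.map_mem σ hσ

section Comparison

variable {V : Type u} {W : Type v} {K : AbstractSimplicialComplex V}
  {L : AbstractSimplicialComplex W}

/-- For `a = ∑ᵢ tᵢ fᵢ` in `|Map_SC(K, L)|` and `x = ∑ⱼ sⱼ vⱼ` in `|K|`, the vector
`∑ᵢⱼ tᵢ sⱼ fᵢ(vⱼ)`. -/
def gammaCoord (a : Realization (contiguityComplex K L)) (x : Realization K) : W →₀ ℝ :=
  a.coord.sum fun f t => x.coord.sum fun v s => Finsupp.single (f.toFun v) (t * s)

theorem gammaCoord_eq (a : Realization (contiguityComplex K L)) (x : Realization K)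
    {s : Finset (SimplicialMap K L)} {σ : Finset V} (hs : a.coord.support ⊆ s)
    (hσ : x.coord.support ⊆ σ) :
    gammaCoord a x = ∑ f ∈ s, ∑ v ∈ σ, Finsupp.single (f.toFun v) (a.coord f * x.coord v) := by
  rw [gammaCoord, Finsupp.sum_of_support_subset _ hs _ (by simp)]
  refine Finset.sum_congr rfl fun f _ => ?_
  rw [Finsupp.sum_of_support_subset _ hσ _ (by simp)]

theorem gammaCoord_nonneg (a : Realization (contiguityComplex K L)) (x : Realization K) (w : W) :
    0 ≤ gammaCoord a x w := by
  classical
  rw [gammaCoord_eq a x subset_rfl subset_rfl, Finsupp.finsetSum_apply]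
  refine Finset.sum_nonneg fun f _ => ?_
  rw [Finsupp.finsetSum_apply]
  refine Finset.sum_nonneg fun v _ => ?_
  rw [Finsupp.single_apply]
  split_ifs
  exacts [mul_nonneg (a.nonneg f) (x.nonneg v), le_rfl]

theorem gammaCoord_degree (a : Realization (contiguityComplex K L)) (x : Realization K) :
    (gammaCoord a x).degree = 1 := by
  rw [gammaCoord_eq a x subset_rfl subset_rfl, map_sum]
  simp only [map_sum, Finsupp.degree_single, ← Finset.mul_sum, ← Finset.sum_mul]
  have ha := a.sum_eq_one
  have hx := x.sum_eq_one
  rw [Finsupp.sum] at ha hx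
  rw [hx, mul_one, ha]

theorem gammaCoord_support (a : Realization (contiguityComplex K L)) (x : Realization K)
    {s : Finset (SimplicialMap K L)} {σ : Finset V} (hs : a.coord.support ⊆ s)
    (hσ : x.coord.support ⊆ σ) : open Classical in
    (gammaCoord a x).support ⊆ Finset.image₂ (fun f v => f.toFun v) s σ := by
  classical
  rw [gammaCoord_eq a x hs hσ]
  refine Finsupp.support_finsetSum.trans (Finset.biUnion_subset.2 fun f hf => ?_)
  refine Finsupp.support_finsetSum.trans (Finset.biUnion_subset.2 fun v hv => ?_)
  exact Finsupp.support_single_subset.trans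
    (Finset.singleton_subset_iff.2 (Finset.mem_image₂_of_mem hf hv))

/-- The function `Γ a : |K| → |L|`, `Γ (∑ᵢ tᵢ fᵢ) (∑ⱼ sⱼ vⱼ) = ∑ᵢⱼ tᵢ sⱼ fᵢ(vⱼ)`. -/
def gammaFun (a : Realization (contiguityComplex K L)) (x : Realization K) : Realization L :=
  .ofSubset (gammaCoord a x) (gammaCoord_nonneg a x) (gammaCoord_degree a x)
    ⟨_, a.support_mem.2 _ x.support_mem, gammaCoord_support a x subset_rfl subset_rfl⟩

theorem continuous_gammaCoord {T : Type*} [TopologicalSpace T]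
    {a : T → Realization (contiguityComplex K L)} {x : T → Realization K}
    (ha : Continuous a) (hx : Continuous x) {s : Finset (SimplicialMap K L)} {σ : Finset V}
    (hs : ∀ t, (a t).coord.support ⊆ s) (hσ : ∀ t, (x t).coord.support ⊆ σ) (w : W) :
    Continuous fun t => gammaCoord (a t) (x t) w := by
  classical
  have : (fun t => gammaCoord (a t) (x t) w) = fun t => ∑ f ∈ s, ∑ v ∈ σ,
      if f.toFun v = w then (a t).coord f * (x t).coord v else 0 := by
    funext t
    rw [gammaCoord_eq _ _ (hs t) (hσ t), Finsupp.finsetSum_apply]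
    simp only [Finsupp.finsetSum_apply, Finsupp.single_apply]
  rw [this]
  refine continuous_finsetSum _ fun f _ => continuous_finsetSum _ fun v _ => ?_
  split_ifs
  exacts [((continuous_coordinate f).comp ha).mul ((continuous_coordinate v).comp hx),
    continuous_const]

theorem gamma_aux (s) (hs : s ∈ contiguityComplex K L) (σ) (hσ : σ ∈ K) :
    (∃ τ ∈ L, ∀ (a : Cell (contiguityComplex K L) s) (_ : Unit) (z : Cell K σ),
        (gammaFun a.pt z.pt).coord.support ⊆ τ) ∧
      ∀ w, Continuous fun q : (Cell (contiguityComplex K L) s × Unit) × Cell K σ =>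
        (gammaFun q.1.1.pt q.2.pt).coord w :=
  ⟨⟨_, hs.2 σ hσ, fun a _ z => gammaCoord_support _ _ a.mem z.mem⟩, fun w =>
    continuous_gammaCoord ((continuous_pt hs).comp (continuous_fst.comp continuous_fst))
      ((continuous_pt hσ).comp continuous_snd) (fun t => t.1.1.mem) (fun t => t.2.mem) w⟩

theorem continuous_gammaFun (a : Realization (contiguityComplex K L)) :
    Continuous (gammaFun a) := by
  obtain ⟨G, hG⟩ := exists_continuous_family (P := Unit) (fun a _ z => gammaFun a z) gamma_aux
  have : gammaFun a = G (a, ()) := funext fun z => (hG a () z).symm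
  rw [this]
  exact (G (a, ())).continuous

/-- The comparison map `Γ : |Map_SC(K, L)| → Map_Top(|K|, |L|)`; the target has the compact-open
topology. -/
def gamma (K : AbstractSimplicialComplex V) (L : AbstractSimplicialComplex W) :
    C(Realization (contiguityComplex K L), C(Realization K, Realization L)) where
  toFun a := ⟨gammaFun a, continuous_gammaFun a⟩
  continuous_toFun :=
    (continuous_family (P := Unit) (fun a _ => ⟨gammaFun a, continuous_gammaFun a⟩)
      gamma_aux).comp (continuous_id.prodMk (continuous_const (y := ())))

end Comparison

section Pullback

variable {V' : Type u} {V : Type v} {W : Type w} {K' : AbstractSimplicialComplex V'}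
  {K : AbstractSimplicialComplex V}

/-- The simplicial map `f^* : Map_SC(K, L) → Map_SC(K', L)`, `g ↦ g ∘ f`, induced by a simplicial map
`f : K' → K`. -/
def SimplicialMap.pullback (f : SimplicialMap K' K) (L : AbstractSimplicialComplex W) :
    SimplicialMap (contiguityComplex K L) (contiguityComplex K' L) where
  toFun g := g.comp f
  map_mem s hs := by
    classical
    refine ⟨hs.1.image _, fun σ hσ => ?_⟩
    have := hs.2 _ (f.map_mem σ hσ)
    convert this using 1
    ext w
    simp only [Finset.mem_image₂, Finset.mem_image]
    constructor
    · rintro ⟨_, ⟨g, hg, rfl⟩, v, hv, rfl⟩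
      exact ⟨g, hg, _, ⟨v, hv, rfl⟩, rfl⟩
    · rintro ⟨g, hg, _, ⟨v, hv, rfl⟩, rfl⟩
      exact ⟨_, ⟨g, hg, rfl⟩, v, hv, rfl⟩

theorem gamma_pullback (f : SimplicialMap K' K) (L : AbstractSimplicialComplex W)
    (a : Realization (contiguityComplex K L)) (z : Realization K') :
    gamma K' L ((f.pullback L).real a) z = gamma K L a (f.real z) := by
  classical
  apply Realization.ext
  change gammaCoord ((f.pullback L).real a) z = gammaCoord a (f.real z)
  have h1 : gammaCoord ((f.pullback L).real a) z =
      a.coord.sum fun g t => z.coord.sum fun v s =>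
        Finsupp.single (g.toFun (f.toFun v)) (t * s) := by
    refine Finsupp.sum_mapDomain_index (by simp) fun g t t' => ?_
    simp only [add_mul, Finsupp.single_add, Finsupp.sum_add]
  rw [h1, gammaCoord]
  refine Finset.sum_congr rfl fun g _ => ?_
  exact (Finsupp.sum_mapDomain_index (f := f.toFun) (s := z.coord)
    (h := fun u s => Finsupp.single (g.toFun u) (a.coord g * s)) (by simp) fun v s s' => by
    rw [mul_add, Finsupp.single_add]).symm

theorem gamma_vertex {L : AbstractSimplicialComplex W} (g : SimplicialMap K L) :
    gamma K L (Realization.vertex _ g) = g.real := by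
  ext1 x
  apply Realization.ext
  change gammaCoord (Realization.vertex _ g) x = x.coord.mapDomain g.toFun
  rw [gammaCoord]
  change (Finsupp.single g (1 : ℝ)).sum _ = _
  rw [Finsupp.sum_single_index (by simp)]
  simp [Finsupp.mapDomain]

theorem real_vertex (f : SimplicialMap K' K) (v : V') :
    f.real (Realization.vertex _ v) = Realization.vertex _ (f.toFun v) := by
  apply Realization.ext
  exact Finsupp.mapDomain_single

end Pullback

/-! ### The linear homotopy of a simplicial approximation -/

section Homotopy

variable {V' : Type u} {V : Type v} {W : Type w} {K' : AbstractSimplicialComplex V'}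
  {K : AbstractSimplicialComplex V} {L : AbstractSimplicialComplex W}

/-- For a simplicial approximation `f : K' → K` of a subdivision homeomorphism `h : |K'| ≅ |K|`, a
point `a` of `|Map_SC(K, L)|`, a time `t` and `x = h z`, the point
`(1 - t) · Γ a (x) + t · Γ a (|f| (h⁻¹ x))` of `|L|`. -/
def linearFun (S : Subdivision K' K) (f : SimplicialMap K' K)
    (hf : IsSimplicialApproximation f (S.homeo : C(Realization K', Realization K)))
    (a : Realization (contiguityComplex K L)) (t : unitInterval) (x : Realization K) :
    Realization L :=
  .ofSubset ((1 - (t : ℝ)) • (gamma K L a x).coord +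
      (t : ℝ) • (gamma K L a (f.real (S.homeo.symm x))).coord)
    (fun w => add_nonneg (mul_nonneg (sub_nonneg.2 t.2.2) (Realization.nonneg _ w))
      (mul_nonneg t.2.1 (Realization.nonneg _ w)))
    (by
      change Finsupp.degree _ = 1
      have h : ∀ (c : ℝ) (x : W →₀ ℝ), (c • x).degree = c * x.degree := fun c x => by
        rw [Finsupp.degree_apply, Finsupp.degree_apply, Finset.mul_sum]
        exact Finset.sum_subset Finsupp.support_smul (fun w _ hw => Finsupp.notMem_support_iff.1 hw)
      rw [map_add, h, h]
      have h1 : ∀ y : Realization L, y.coord.degree = 1 := fun y => y.sum_eq_one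
      rw [h1, h1]
      ring)
    (by
      classical
      refine ⟨_, a.support_mem.2 _ x.support_mem, ?_⟩
      refine Finsupp.support_add.trans (Finset.union_subset
        (Finsupp.support_smul.trans (gammaCoord_support a x subset_rfl subset_rfl))
        (Finsupp.support_smul.trans (gammaCoord_support a _ subset_rfl ?_)))
      refine hf _ _ x.support_mem ?_
      change (S.homeo (S.homeo.symm x)).coord.support = _
      rw [S.homeo.apply_symm_apply])

theorem linear_aux (S : Subdivision K' K) (f : SimplicialMap K' K)
    (hf : IsSimplicialApproximation f (S.homeo : C(Realization K', Realization K)))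
    (s) (hs : s ∈ contiguityComplex K L) (σ) (hσ : σ ∈ K') :
    (∃ τ ∈ L, ∀ (a : Cell (contiguityComplex K L) s) (t : unitInterval) (z : Cell K' σ),
        (linearFun S f hf a.pt t (S.homeo z.pt)).coord.support ⊆ τ) ∧
      ∀ w, Continuous fun q : (Cell (contiguityComplex K L) s × unitInterval) × Cell K' σ =>
        (linearFun S f hf q.1.1.pt q.1.2 (S.homeo q.2.pt)).coord w := by
  classical
  obtain ⟨ρ, hρ, h⟩ := S.exists_cell hσ
  have h1 : ∀ z : Cell K' σ, (S.homeo z.pt).coord.support ⊆ ρ := fun z => h _ z.mem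
  have h2 : ∀ z : Cell K' σ,
      (f.real (S.homeo.symm (S.homeo z.pt))).coord.support ⊆ ρ := fun z => by
    rw [S.homeo.symm_apply_apply]
    exact (hf z.pt _ (S.homeo z.pt).support_mem rfl).trans (h1 z)
  refine ⟨⟨_, hs.2 ρ hρ, fun a t z => ?_⟩, fun w => ?_⟩
  · exact Finsupp.support_add.trans (Finset.union_subset
      (Finsupp.support_smul.trans (gammaCoord_support _ _ a.mem (h1 z)))
      (Finsupp.support_smul.trans (gammaCoord_support _ _ a.mem (h2 z))))
  · have ha : Continuous fun q : (Cell (contiguityComplex K L) s × unitInterval) × Cell K' σ =>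
        q.1.1.pt := (continuous_pt hs).comp (continuous_fst.comp continuous_fst)
    have ht : Continuous fun q : (Cell (contiguityComplex K L) s × unitInterval) × Cell K' σ =>
        (q.1.2 : ℝ) := continuous_subtype_val.comp (continuous_snd.comp continuous_fst)
    have hz : Continuous fun q : (Cell (contiguityComplex K L) s × unitInterval) × Cell K' σ =>
        S.homeo q.2.pt := S.homeo.continuous.comp ((continuous_pt hσ).comp continuous_snd)
    have hz' := (f.real.continuous.comp S.homeo.symm.continuous).comp hz
    exact ((continuous_const.sub ht).mul (continuous_gammaCoord ha hz (fun q => q.1.1.mem)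
      (fun q => h1 q.2) w)).add (ht.mul (continuous_gammaCoord ha hz' (fun q => q.1.1.mem)
      (fun q => h2 q.2) w))

theorem continuous_linearFun (S : Subdivision K' K) (f : SimplicialMap K' K)
    (hf : IsSimplicialApproximation f (S.homeo : C(Realization K', Realization K)))
    (a : Realization (contiguityComplex K L)) (t : unitInterval) :
    Continuous (linearFun S f hf a t) := by
  obtain ⟨G, hG⟩ := exists_continuous_family (fun a t z => linearFun S f hf a t (S.homeo z))
    (linear_aux (L := L) S f hf)
  have : linearFun S f hf a t = G (a, t) ∘ S.homeo.symm := funext fun x => by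
    simp [hG]
  rw [this]
  exact (G (a, t)).continuous.comp S.homeo.symm.continuous

/-- The homotopy `|Map_SC(K, L)| × [0, 1] → Map_Top(|K|, |L|)` from `Γ a` to `Γ a ∘ |f| ∘ h⁻¹`, for a
simplicial approximation `f : K' → K` of a subdivision homeomorphism `h : |K'| ≅ |K|`:
`(a, t) ↦ (1 - t) · Γ a + t · Γ a ∘ |f| ∘ h⁻¹`. -/
def linearHomotopy (S : Subdivision K' K) (f : SimplicialMap K' K)
    (hf : IsSimplicialApproximation f (S.homeo : C(Realization K', Realization K)))
    (L : AbstractSimplicialComplex W) :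
    C(Realization (contiguityComplex K L) × unitInterval, C(Realization K, Realization L)) where
  toFun q := ⟨linearFun S f hf q.1 q.2, continuous_linearFun S f hf q.1 q.2⟩
  continuous_toFun := by
    have h := continuous_family (K := K')
      (fun a t => (⟨linearFun S f hf a t, continuous_linearFun S f hf a t⟩ :
        C(Realization K, Realization L)).comp (S.homeo : C(Realization K', Realization K)))
      (linear_aux (L := L) S f hf)
    have h' := (ContinuousMap.continuous_precomp
      (S.homeo.symm : C(Realization K, Realization K'))).comp h
    convert h' using 1
    funext q
    ext1 x
    simp

theorem linearHomotopy_zero (S : Subdivision K' K) (f : SimplicialMap K' K)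
    (hf : IsSimplicialApproximation f (S.homeo : C(Realization K', Realization K)))
    (a : Realization (contiguityComplex K L)) :
    linearHomotopy S f hf L (a, 0) = gamma K L a := by
  ext1 x
  apply Realization.ext
  change (1 - ((0 : unitInterval) : ℝ)) • (gamma K L a x).coord +
    ((0 : unitInterval) : ℝ) • _ = _
  simp

theorem linearHomotopy_one (S : Subdivision K' K) (f : SimplicialMap K' K)
    (hf : IsSimplicialApproximation f (S.homeo : C(Realization K', Realization K)))
    (a : Realization (contiguityComplex K L)) (x : Realization K) :
    linearHomotopy S f hf L (a, 1) x = gamma K L a (f.real (S.homeo.symm x)) := by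
  apply Realization.ext
  change (1 - ((1 : unitInterval) : ℝ)) • (gamma K L a x).coord +
    ((1 : unitInterval) : ℝ) • _ = _
  simp

end Homotopy

/-! ### Towers of subdivisions, the telescope and the map `Φ` -/

/-- The standing data: for each `n`, the structure of a subdivision of `X n` on `X (n + 1)`, and a
simplicial approximation `X (n + 1) → X n` of the homeomorphism `|X (n + 1)| ≅ |X n|`. -/
structure SubdivisionTower {V : ℕ → Type u} (X : ∀ n, AbstractSimplicialComplex (V n)) where
  sub : ∀ n, Subdivision (X (n + 1)) (X n)
  map : ∀ n, SimplicialMap (X (n + 1)) (X n)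
  approx : ∀ n, IsSimplicialApproximation (map n)
    ((sub n).homeo : C(Realization (X (n + 1)), Realization (X n)))

/-- The telescope of `φ₀ : A₀ → A₁`, `φ₁ : A₁ → A₂`, …: the disjoint union of the `Aₙ × [0, 1]`, with
`(a, 1)` in the `n`-th piece glued to `(φₙ a, 0)` in the next piece. -/
inductive Telescope.Rel {A : ℕ → Type u} [∀ n, TopologicalSpace (A n)]
    (φ : ∀ n, C(A n, A (n + 1))) :
    (Σ n, A n × unitInterval) → (Σ n, A n × unitInterval) → Prop
  | glue (n : ℕ) (a : A n) : Telescope.Rel φ ⟨n, (a, 1)⟩ ⟨n + 1, (φ n a, 0)⟩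

/-- The telescope, with the quotient topology. -/
def Telescope {A : ℕ → Type u} [∀ n, TopologicalSpace (A n)] (φ : ∀ n, C(A n, A (n + 1))) :
    Type u :=
  Quot (Telescope.Rel φ)

instance {A : ℕ → Type u} [∀ n, TopologicalSpace (A n)] (φ : ∀ n, C(A n, A (n + 1))) :
    TopologicalSpace (Telescope φ) :=
  inferInstanceAs (TopologicalSpace (Quot (Telescope.Rel φ)))

namespace SubdivisionTower

variable {V : ℕ → Type u} {X : ∀ n, AbstractSimplicialComplex (V n)} {W : Type v}

/-- The tower `X k, X (k + 1), …`. -/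
def shift (T : SubdivisionTower X) (k : ℕ) : SubdivisionTower fun m => X (k + m) where
  sub m := T.sub (k + m)
  map m := T.map (k + m)
  approx m := T.approx (k + m)

/-- `X n` as a subdivision of `X 0`. -/
def toBase (T : SubdivisionTower X) : ∀ n, Subdivision (X n) (X 0)
  | 0 => Subdivision.refl (X 0)
  | n + 1 => (T.sub n).trans (T.toBase n)

/-- The composite simplicial map `X n → X (n - 1) → ⋯ → X 0`. -/
def mapToBase (T : SubdivisionTower X) : ∀ n, SimplicialMap (X n) (X 0)
  | 0 => SimplicialMap.id (X 0)
  | n + 1 => (T.mapToBase n).comp (T.map n)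

theorem approxToBase (T : SubdivisionTower X) : ∀ n, IsSimplicialApproximation (T.mapToBase n)
    ((T.toBase n).homeo : C(Realization (X n), Realization (X 0)))
  | 0 => isSimplicialApproximation_id _
  | n + 1 => (T.approxToBase n).comp (T.approx n)

/-- The space `Aₙ = |Map_SC(Xₙ, Y)|`. -/
abbrev mapSpace (_ : SubdivisionTower X) (Y : AbstractSimplicialComplex W) (n : ℕ) :
    Type (max u v) :=
  Realization (contiguityComplex (X n) Y)

/-- The map `φₙ = |fₙ^*| : Aₙ → Aₙ₊₁`. -/
def transition (T : SubdivisionTower X) (Y : AbstractSimplicialComplex W) (n : ℕ) :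
    C(T.mapSpace Y n, T.mapSpace Y (n + 1)) :=
  ((T.map n).pullback Y).real

/-- The homeomorphism `Map_Top(|Xₙ|, |Y|) ≅ Map_Top(|X₀|, |Y|)` induced by `|Xₙ| ≅ |X₀|`, as a
continuous map. -/
def restrict (T : SubdivisionTower X) (Y : AbstractSimplicialComplex W) (n : ℕ) :
    C(C(Realization (X n), Realization Y), C(Realization (X 0), Realization Y)) where
  toFun ψ := ψ.comp ((T.toBase n).homeo.symm : C(Realization (X 0), Realization (X n)))
  continuous_toFun := ContinuousMap.continuous_precomp _

/-- The map `Aₙ → Map_Top(|Xₙ|, |Y|) ≅ Map_Top(|X₀|, |Y|)` induced by `Γ`. -/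
def compare (T : SubdivisionTower X) (Y : AbstractSimplicialComplex W) (n : ℕ) :
    C(T.mapSpace Y n, C(Realization (X 0), Realization Y)) :=
  (T.restrict Y n).comp (gamma (X n) Y)

/-- The telescope `F` of the maps `φₙ`. -/
abbrev Tel (T : SubdivisionTower X) (Y : AbstractSimplicialComplex W) : Type (max u v) :=
  Telescope (T.transition Y)

/-- The piece of `Φ` on `Aₙ × [0, 1]`: the linear homotopy between the two maps
`Aₙ → Map_Top(|Xₙ|, |Y|) ≅ Map_Top(|X₀|, |Y|)` and
`Aₙ → Map_Top(|Xₙ|, |Y|) → Map_Top(|Xₙ₊₁|, |Y|) ≅ Map_Top(|X₀|, |Y|)`, the second of which uses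
precomposition with `|fₙ|`. -/
def piece (T : SubdivisionTower X) (Y : AbstractSimplicialComplex W) (n : ℕ) :
    C(T.mapSpace Y n × unitInterval, C(Realization (X 0), Realization Y)) :=
  (T.restrict Y n).comp (linearHomotopy (T.sub n) (T.map n) (T.approx n) Y)

theorem piece_zero (T : SubdivisionTower X) (Y : AbstractSimplicialComplex W) (n : ℕ)
    (a : T.mapSpace Y n) : T.piece Y n (a, 0) = T.compare Y n a :=
  congrArg (T.restrict Y n) (linearHomotopy_zero (T.sub n) (T.map n) (T.approx n) a)

theorem piece_one (T : SubdivisionTower X) (Y : AbstractSimplicialComplex W) (n : ℕ)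
    (a : T.mapSpace Y n) :
    T.piece Y n (a, 1) = T.compare Y (n + 1) (T.transition Y n a) := by
  ext1 x
  refine (linearHomotopy_one (T.sub n) (T.map n) (T.approx n) a _).trans ?_
  exact (gamma_pullback (T.map n) Y a _).symm

/-- The comparison map `Φ : F → Map_Top(|X₀|, |Y|)`. -/
def Phi (T : SubdivisionTower X) (Y : AbstractSimplicialComplex W) :
    C(T.Tel Y, C(Realization (X 0), Realization Y)) where
  toFun := Quot.lift (fun p => T.piece Y p.1 p.2) (by
    rintro _ _ ⟨n, a⟩
    exact (T.piece_one Y n a).trans (T.piece_zero Y (n + 1) _).symm)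
  continuous_toFun := continuous_quot_lift _ (continuous_sigma fun n => (T.piece Y n).continuous)

end SubdivisionTower

/-! ### Homotopy groups and weak equivalences -/

section HomotopyGroups

variable {A : Type u} {B : Type v} [TopologicalSpace A] [TopologicalSpace B]

/-- The map on sets of path components induced by a continuous map. -/
def pi0Map (f : C(A, B)) : ZerothHomotopy A → ZerothHomotopy B :=
  ZerothHomotopy.lift (fun a => ZerothHomotopy.mk (f a)) fun _ _ p =>
    ZerothHomotopy.sound (p.map f.continuous)

/-- Composition of an `N`-dimensional loop with a continuous map `f` taking `a` to `b`. -/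
def mapLoop {N : Type*} (f : C(A, B)) {a : A} {b : B} (h : f a = b) (p : Ω^ N A a) : Ω^ N B b :=
  ⟨f.comp p.1, fun y hy => by
    rw [ContinuousMap.comp_apply, p.2 y hy, h]⟩

/-- The map `π_N(A, a) → π_N(B, b)` induced by a continuous map `f` taking `a` to `b`. -/
def piMap {N : Type*} (f : C(A, B)) {a : A} {b : B} (h : f a = b) :
    HomotopyGroup N A a → HomotopyGroup N B b :=
  Quotient.map (mapLoop f h) fun _ _ H => ContinuousMap.HomotopicRel.comp_continuousMap H f

/-- The induced map on homotopy groups as a homomorphism of groups. -/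
def piHom {N : Type*} [DecidableEq N] [Nonempty N] (f : C(A, B)) {a : A} {b : B} (h : f a = b) :
    HomotopyGroup N A a →* HomotopyGroup N B b :=
  MonoidHom.mk' (piMap f h) (by
    rintro ⟨p⟩ ⟨q⟩
    have i : N := Classical.arbitrary N
    have h1 := HomotopyGroup.mul_spec (i := i) (p := p) (q := q)
    have h2 := HomotopyGroup.mul_spec (i := i) (p := mapLoop f h p) (q := mapLoop f h q)
    refine (congrArg (piMap f h) h1).trans (Eq.trans ?_ h2.symm)
    refine congrArg (Quotient.mk _) (GenLoop.ext _ _ fun y => ?_)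
    change f (GenLoop.transAt i q p y) = GenLoop.transAt i (mapLoop f h q) (mapLoop f h p) y
    simp only [GenLoop.transAt, GenLoop.coe_copy]
    split_ifs <;> rfl)

/-- A weak (homotopy) equivalence: a continuous map inducing a bijection on path components and, for
each base point and each `q ≥ 1` (written `q + 1` below), an isomorphism on `π_q`. -/
def IsWeakEquivalence (f : C(A, B)) : Prop :=
  Function.Bijective (pi0Map f) ∧
    ∀ (a : A) (q : ℕ), Function.Bijective
      (piHom f (rfl : f a = f a) : π_ (q + 1) A a →* π_ (q + 1) B (f a))

/-- The loops `p` at `a` and `r` at `b` are freely homotopic along the path `γ` from `a` to `b`: there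
is a homotopy from `p` to `r` which at each time `s` is constant, equal to `γ s`, on the boundary of
the cube. That is, the change of base point along `γ` takes the class of `p` to the class of `r`. -/
def HomotopicAlong {N : Type*} {a b : A} (γ : Path a b) (p : Ω^ N A a) (r : Ω^ N A b) : Prop :=
  ∃ H : C(unitInterval × (N → unitInterval), A),
    (∀ y, H (0, y) = p y) ∧ (∀ y, H (1, y) = r y) ∧
      ∀ s, ∀ y ∈ Cube.boundary N, H (s, y) = γ s

end HomotopyGroups

namespace SubdivisionTower

variable {V : ℕ → Type u} {X : ∀ n, AbstractSimplicialComplex (V n)} {W : Type v}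
  {Y : AbstractSimplicialComplex W}

/-- The vertex `g ∘ f`, with `f : X n → X 0` the composite simplicial map, as a point of
`|Map_SC(X n, Y)|`. -/
def basePoint (T : SubdivisionTower X) (g : SimplicialMap (X 0) Y) (n : ℕ) : T.mapSpace Y n :=
  Realization.vertex _ (g.comp (T.mapToBase n))

theorem transition_basePoint (T : SubdivisionTower X) (g : SimplicialMap (X 0) Y) (n : ℕ) :
    T.transition Y n (T.basePoint g n) = T.basePoint g (n + 1) :=
  real_vertex _ _

/-- The gluing relation for the colimit over `n` of the groups `π_q(|Map_SC(X n, Y)|, g ∘ f)`. -/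
inductive PiColim.Rel (T : SubdivisionTower X) (g : SimplicialMap (X 0) Y) (q : ℕ) :
    (Σ n, π_ q (T.mapSpace Y n) (T.basePoint g n)) →
      (Σ n, π_ q (T.mapSpace Y n) (T.basePoint g n)) → Prop
  | glue (n : ℕ) (c : π_ q (T.mapSpace Y n) (T.basePoint g n)) :
      PiColim.Rel T g q ⟨n, c⟩
        ⟨n + 1, piMap (T.transition Y n) (T.transition_basePoint g n) c⟩

/-- The colimit over `n` of `π_q(|Map_SC(X n, Y)|, g ∘ f)` along the maps induced by the `φₙ`. -/
def PiColim (T : SubdivisionTower X) (g : SimplicialMap (X 0) Y) (q : ℕ) : Type (max u v) :=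
  Quot (PiColim.Rel T g q)

/-- The element of the colimit represented by a loop in `|Map_SC(X n, Y)|`. -/
def PiColim.mk (T : SubdivisionTower X) (g : SimplicialMap (X 0) Y) (q n : ℕ)
    (p : Ω^ (Fin q) (T.mapSpace Y n) (T.basePoint g n)) : PiColim T g q :=
  Quot.mk _ ⟨n, Quotient.mk _ p⟩

/-- As `g ∘ f : X n → Y` is a simplicial approximation of `|X n| ≅ |X 0| → |Y|`, the linear homotopy
is a path from the image of `g ∘ f` in `Map_Top(|X 0|, |Y|)` to `|g|`. -/
def basePath (T : SubdivisionTower X) (g : SimplicialMap (X 0) Y) (n : ℕ) :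
    Path (T.compare Y n (T.basePoint g n)) g.real where
  toFun t := linearHomotopy (T.toBase n) (T.mapToBase n) (T.approxToBase n) Y
    (Realization.vertex _ g, unitInterval.symm t)
  continuous_toFun := (ContinuousMap.continuous _).comp
    (continuous_const.prodMk unitInterval.continuous_symm)
  source' := by
    rw [unitInterval.symm_zero]
    ext1 x
    refine (linearHomotopy_one _ _ _ _ _).trans ?_
    refine (gamma_pullback _ _ _ _).symm.trans ?_
    rw [real_vertex]
    rfl
  target' := by
    rw [unitInterval.symm_one, linearHomotopy_zero, gamma_vertex]

/-- `θ` is the map `colim_n π_q(|Map_SC(X n, Y)|, g ∘ f) → π_q(Map_Top(|X 0|, |Y|), |g|)` induced by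
the comparison maps `|Map_SC(X n, Y)| → Map_Top(|X 0|, |Y|)` and the change of base point along the
linear homotopy from the image of `g ∘ f` to `|g|`. -/
def IsComparison (T : SubdivisionTower X) (g : SimplicialMap (X 0) Y) (q : ℕ)
    (θ : PiColim T g q → π_ q C(Realization (X 0), Realization Y) g.real) : Prop :=
  ∀ (n : ℕ) (p : Ω^ (Fin q) (T.mapSpace Y n) (T.basePoint g n))
    (r : Ω^ (Fin q) C(Realization (X 0), Realization Y) g.real),
    θ (PiColim.mk T g q n p) = Quotient.mk _ r ↔
      HomotopicAlong (T.basePath g n) (mapLoop (T.compare Y n) rfl p) r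

end SubdivisionTower

end ContiguityComplex

end

/-! Call `φ` subordinate to `ψ` (`SupportLE`) if each `φ x` lies in the closed simplex whose
interior contains `ψ x`. The segments from `φ x` to `ψ x` then form a homotopy. A point of `A n` is
carried by `ψ` (`Carried`) if its image under the comparison map is subordinate to `ψ`, that is, if
the simplicial maps occurring in it are simplicial approximations of `ψ` on `|X n|`. Approximations
of one map at one level are contiguous (`face_of_carried`), so any two carried points are joined by
a segment of carried points. Transition maps preserve the property.

Small mesh provides carried points. Each `ψ` has a simplicial approximation at every large level,
and it also serves all maps near `ψ` (`exists_carried_nhds`). With a partition of unity, every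
compact family of maps is carried by a continuous family in a single `A n`
(`exists_carried_family`). Such a family can be corrected to prescribed values on a closed set, if
these are carried nearby (`exists_carried_modification`). For loops this gives surjectivity on
homotopy groups (`exists_carried_loop`). For homotopies it shows that loops in `A n` with homotopic
images become homotopic after finitely many transitions (`exists_homotopic_transitions`). Up to base
points, this is the statement on colimits (`comparison_bijective`).

In the telescope, a compact set has bounded time, so the flow pushes it into one `A n`; this reduces
injectivity to loops in `A n` (`homotopic_of_Phi_aux`). For surjectivity, each `z` is joined to
points of `A n`, for `n` large, by a path on which `Φ` stays subordinate to `Φ z`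
(`exists_path_incl`). Base points are moved by surrounding a loop with a radial collar (`transport`,
`homotopicAlong_iff`). Injectivity on path components is the case of the zero-dimensional cube. -/

noncomputable section

namespace ContiguityComplex

/-! ### Topology of the realization -/

section RealizationTopology

variable {V : Type u} {K : AbstractSimplicialComplex V}

theorem coord_injective :
    Function.Injective fun (x : Realization K) (v : V) => x.coord v :=
  fun _ _ h => eq_of_coord fun v => congrFun h v

theorem continuous_coords : Continuous fun (x : Realization K) (v : V) => x.coord v :=
  continuous_pi fun v => continuous_coordinate v

instance : T2Space (Realization K) :=
  T2Space.of_injective_continuous coord_injective continuous_coords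

theorem mem_support_iff_pos {x : Realization K} {v : V} :
    v ∈ x.coord.support ↔ 0 < x.coord v := by
  rw [Finsupp.mem_support_iff]
  exact ⟨fun h => lt_of_le_of_ne (x.nonneg v) (Ne.symm h), fun h => h.ne'⟩

/-- The barycentre. It allows conditions stated for all points of `|K|` to be tested on simplices.
-/
theorem exists_support_eq {σ : Finset V} (hσ : σ ∈ K) :
    ∃ x : Realization K, x.coord.support = σ := by
  classical
  have hcard : (0 : ℝ) < σ.card := by exact_mod_cast (nonempty_of_mem hσ).card_pos
  let b : V →₀ ℝ := Finsupp.indicator σ fun _ _ => (σ.card : ℝ)⁻¹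
  have hb : ∀ v, b v = if v ∈ σ then (σ.card : ℝ)⁻¹ else 0 := fun v => by
    simp [b, Finsupp.indicator_apply]
  have hs : b.support = σ := by
    ext v
    rw [Finsupp.mem_support_iff, hb]
    by_cases h : v ∈ σ <;> simp [h, hcard.ne']
  refine ⟨.ofSubset b (fun v => ?_) ?_ ⟨σ, hσ, hs.subset⟩, hs⟩
  · rw [hb]
    split_ifs <;> positivity
  · rw [Finsupp.sum, hs, Finset.sum_congr rfl fun v hv => (hb v).trans (if_pos hv)]
    simp [hcard.ne']

theorem compactSpace_cell {σ : Finset V} (hσ : σ ∈ K) : CompactSpace (Cell K σ) := by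
  classical
  have hr : Set.range (fun (x : Cell K σ) (v : V) => x.pt.coord v) =
      {y | (∀ v, 0 ≤ y v) ∧ (∑ v ∈ σ, y v) = 1 ∧ ∀ v, v ∉ σ → y v = 0} := by
    ext y
    constructor
    · rintro ⟨x, rfl⟩
      refine ⟨x.pt.nonneg, ?_, fun v hv => ?_⟩
      · rw [← x.pt.sum_eq_one]
        exact (Finsupp.sum_of_support_subset x.pt.coord x.mem (fun _ t => t) fun _ _ => rfl).symm
      · exact Finsupp.notMem_support_iff.1 fun h => hv (x.mem h)
    · rintro ⟨h0, h1, h2⟩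
      let z : V →₀ ℝ := Finsupp.onFinset σ y fun v hv => by
        by_contra h
        exact hv (h2 v h)
      have hz : z.support ⊆ σ := Finsupp.support_onFinset_subset
      have hs : (z.sum fun _ t => t) = 1 := by
        rw [Finsupp.sum_of_support_subset _ hz _ fun _ _ => rfl]
        exact h1
      exact ⟨⟨.ofSubset z h0 hs ⟨σ, hσ, hz⟩, hz⟩, rfl⟩
  have hclosed : IsClosed (Set.range (fun (x : Cell K σ) (v : V) => x.pt.coord v)) := by
    rw [hr]
    simp only [Set.ofPred_and, Set.ofPred_forall]
    refine IsClosed.inter ?_ (IsClosed.inter ?_ ?_)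
    · exact isClosed_iInter fun v => isClosed_le continuous_const (continuous_apply v)
    · exact isClosed_eq (by fun_prop) continuous_const
    · exact isClosed_iInter fun v => isClosed_iInter fun _ =>
        isClosed_eq (continuous_apply v) continuous_const
  have hsub : Set.range (fun (x : Cell K σ) (v : V) => x.pt.coord v) ⊆
      Set.univ.pi fun _ => Set.Icc (0 : ℝ) 1 := by
    rintro _ ⟨x, rfl⟩ v _
    exact ⟨x.pt.nonneg v, coord_le_one _ v⟩
  rw [← isCompact_univ_iff, isEmbedding_coord.isCompact_iff, Set.image_univ]
  exact (isCompact_univ_pi fun _ : V => isCompact_Icc (a := (0 : ℝ)) (b := 1)).of_isClosed_subset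
    hclosed hsub

theorem compactSpace_of_finite [Finite V] : CompactSpace (Realization K) := by
  have h : (Set.univ : Set (Realization K)) =
      ⋃ σ ∈ {σ : Finset V | σ ∈ K}, Set.range (Cell.pt : Cell K σ → Realization K) := by
    refine (Set.eq_univ_of_forall fun x => ?_).symm
    exact Set.mem_biUnion (x := x.coord.support) x.support_mem ⟨⟨x, Finset.Subset.refl _⟩, rfl⟩
  rw [← isCompact_univ_iff, h]
  refine (Set.toFinite _).isCompact_biUnion fun σ hσ => ?_
  have := compactSpace_cell hσ
  exact isCompact_range (continuous_pt hσ)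

theorem isClosed_of_finite_inter {D : Set (Realization K)}
    (h : ∀ σ ∈ K, (D ∩ closedSimplex K σ).Finite) : IsClosed D := by
  rw [← isOpen_compl_iff, isOpen_iff]
  intro σ hσ
  rw [Set.preimage_compl, isOpen_compl_iff]
  have : T2Space (Cell K σ) := isEmbedding_coord.t2Space
  refine Set.Finite.isClosed ?_
  refine Set.Finite.of_finite_image ((h σ hσ).subset ?_) (f := Cell.pt)
    (fun x _ y _ hxy => Cell.ext hxy)
  rintro _ ⟨x, hx, rfl⟩
  exact ⟨hx, x.mem⟩

/-- A compact subset of a realization meets only finitely many open stars. -/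
theorem finite_iUnion_support {C : Set (Realization K)} (hC : IsCompact C) :
    (⋃ x ∈ C, (x.coord.support : Set V)).Finite := by
  set U := ⋃ x ∈ C, (x.coord.support : Set V)
  have hex : ∀ v : U, ∃ x ∈ C, (v : V) ∈ x.coord.support := fun v => by
    obtain ⟨x, hx, hv⟩ := Set.mem_iUnion₂.1 v.2
    exact ⟨x, hx, hv⟩
  choose p hpC hp using hex
  -- One point of `C` has been chosen in the open star of each vertex that occurs. A chosen point in
  -- a closed simplex `σ` was chosen for a vertex of `σ`, so each `σ` contains only finitely many.
  -- Every set of chosen points is therefore closed, and these points form a discrete compact set.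
  have hclosed : ∀ D ⊆ Set.range p, IsClosed D := fun D hD => by
    refine isClosed_of_finite_inter fun σ _ => ?_
    refine ((σ.finite_toSet.preimage Subtype.val_injective.injOn).image p).subset ?_
    rintro x ⟨hx, hxσ⟩
    obtain ⟨v, rfl⟩ := hD hx
    exact ⟨v, hxσ (hp v), rfl⟩
  have hd : DiscreteTopology (Set.range p) := by
    rw [discreteTopology_iff_forall_isClosed]
    intro s
    have := (hclosed (Subtype.val '' s) (by simp)).preimage
      (continuous_subtype_val (p := (· ∈ Set.range p)))
    rwa [Set.preimage_image_eq _ Subtype.val_injective] at this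
  have hfin : (Set.range p).Finite := by
    have hc : IsCompact (Set.range p) := hC.of_isClosed_subset (hclosed _ subset_rfl)
      (Set.range_subset_iff.2 hpC)
    exact hc.finite ⟨hd⟩
  refine (hfin.biUnion fun x _ => x.coord.support.finite_toSet).subset fun v hv => ?_
  exact Set.mem_biUnion ⟨⟨v, hv⟩, rfl⟩ (hp ⟨v, hv⟩)

/-- Only the bottom complex of a tower is assumed finite; the subdivisions inherit finiteness
through compactness of their realizations. -/
theorem finite_of_compactSpace [CompactSpace (Realization K)] : Finite V := by
  rw [← Set.finite_univ_iff]
  refine (finite_iUnion_support (K := K) isCompact_univ).subset fun v _ => ?_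
  obtain ⟨x, hx⟩ := exists_support_eq (K.singleton_mem v)
  exact Set.mem_biUnion (Set.mem_univ x) (by simp [hx])

/-- A map into a finite subcomplex is continuous if its barycentric coordinates are. -/
theorem continuous_of_coord {T : Type*} [TopologicalSpace T] {f : T → Realization K}
    {s : Set V} (hs : s.Finite) (hf : ∀ t, ((f t).coord.support : Set V) ⊆ s)
    (hc : ∀ v, Continuous fun t => (f t).coord v) : Continuous f := by
  classical
  let ι := {σ : Finset V // σ ∈ hs.toFinset.powerset ∧ σ ∈ K}
  have : Finite ι := Set.Finite.subset (Finset.finite_toSet hs.toFinset.powerset) fun _ h => h.1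
  let g : ι → Set T := fun σ => {t | (f t).coord.support ⊆ σ.1}
  refine LocallyFinite.continuous (f := g) (locallyFinite_of_finite _) ?_ ?_ ?_
  · refine Set.eq_univ_of_forall fun t => Set.mem_iUnion.2
      ⟨⟨(f t).coord.support, ?_, (f t).support_mem⟩, Finset.Subset.refl _⟩
    rw [Finset.mem_powerset]
    intro v hv
    simpa using hf t hv
  · intro σ
    have : g σ = ⋂ v ∉ σ.1, {t | (f t).coord v = 0} := by
      ext t
      simp only [g, Set.mem_ofPred_eq, Set.mem_iInter]
      exact ⟨fun h v hv => Finsupp.notMem_support_iff.1 fun h' => hv (h h'), fun h v hv => by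
        by_contra hn
        exact Finsupp.mem_support_iff.1 hv (h v hn)⟩
    rw [this]
    exact isClosed_iInter fun v => isClosed_iInter fun _ => isClosed_eq (hc v) continuous_const
  · intro σ
    rw [continuousOn_iff_continuous_domRestrict]
    exact continuous_cod σ.2.2 (fun t => t.2) fun v => (hc v).comp continuous_subtype_val

theorem finite_iUnion_support_range {T : Type*} [TopologicalSpace T] [CompactSpace T]
    {f : T → Realization K} (hf : Continuous f) :
    (⋃ t, ((f t).coord.support : Set V)).Finite := by
  have := finite_iUnion_support (isCompact_range hf)
  simpa using this

end RealizationTopology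

/-! ### Segments in a realization -/

section Mix

variable {V : Type u} {K : AbstractSimplicialComplex V}

/-- The points `x` and `y` lie in a common closed simplex. -/
def Compatible (x y : Realization K) : Prop :=
  ∃ τ ∈ K, x.coord.support ⊆ τ ∧ y.coord.support ⊆ τ

theorem degree_combination (x y : Realization K) (t : ℝ) :
    (((1 - t) • x.coord + t • y.coord).sum fun _ t => t) = 1 := by
  change Finsupp.degree _ = 1
  have h : ∀ (c : ℝ) (x : V →₀ ℝ), (c • x).degree = c * x.degree := fun c x => by
    rw [Finsupp.degree_apply, Finsupp.degree_apply, Finset.mul_sum]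
    exact Finset.sum_subset Finsupp.support_smul (fun w _ hw => Finsupp.notMem_support_iff.1 hw)
  rw [map_add, h, h]
  have h1 : ∀ y : Realization K, y.coord.degree = 1 := fun y => y.sum_eq_one
  rw [h1, h1]
  ring

open Classical in
/-- The point `(1 - t) x + t y`, when `x` and `y` lie in a common simplex (or `t = 0`). -/
def mix (x y : Realization K) (t : unitInterval) : Realization K :=
  if h : Compatible x y then
    .ofSubset ((1 - (t : ℝ)) • x.coord + (t : ℝ) • y.coord)
      (fun v => add_nonneg (mul_nonneg (sub_nonneg.2 t.2.2) (x.nonneg v))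
        (mul_nonneg t.2.1 (y.nonneg v)))
      (degree_combination x y t)
      (by
        obtain ⟨τ, hτ, hx, hy⟩ := h
        exact ⟨τ, hτ, Finsupp.support_add.trans (Finset.union_subset
          (Finsupp.support_smul.trans hx) (Finsupp.support_smul.trans hy))⟩)
  else x

/-- At `t = 0` the ends need not be compatible, since the default value of `mix` is `x`. A segment
governed by a cutoff function is thus well behaved even if its ends are compatible only where the
cutoff is non-zero. -/
theorem mix_coord {x y : Realization K} {t : unitInterval} (h : t = 0 ∨ Compatible x y) :
    (mix x y t).coord = (1 - (t : ℝ)) • x.coord + (t : ℝ) • y.coord := by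
  by_cases hc : Compatible x y
  · rw [mix, dif_pos hc]
    rfl
  · rw [mix, dif_neg hc, h.resolve_right hc]
    simp

theorem mix_coord_apply {x y : Realization K} {t : unitInterval} (h : t = 0 ∨ Compatible x y)
    (v : V) : (mix x y t).coord v = (1 - (t : ℝ)) * x.coord v + (t : ℝ) * y.coord v := by
  rw [mix_coord h]
  rfl

@[simp]
theorem mix_zero (x y : Realization K) : mix x y 0 = x :=
  Realization.ext (by rw [mix_coord (Or.inl rfl)]; simp)

theorem mix_one {x y : Realization K} (h : Compatible x y) : mix x y 1 = y :=
  Realization.ext (by rw [mix_coord (Or.inr h)]; simp)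

@[simp]
theorem mix_self (x : Realization K) (t : unitInterval) : mix x x t = x :=
  Realization.ext (by
    rw [mix_coord (Or.inr ⟨_, x.support_mem, subset_rfl, subset_rfl⟩), ← add_smul]
    simp)

theorem mem_support_mix {x y : Realization K} {t : unitInterval} {v : V}
    (h : v ∈ (mix x y t).coord.support) :
    v ∈ x.coord.support ∨ (t ≠ 0 ∧ v ∈ y.coord.support) := by
  by_cases ht : t = 0
  · left
    simpa [ht] using h
  by_cases hc : Compatible x y
  · rw [mem_support_iff_pos, mix_coord_apply (Or.inr hc)] at h
    simp only [mem_support_iff_pos]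
    by_contra! hn
    have h1 := hn.2 ht
    have h2 : (1 - (t : ℝ)) * x.coord v ≤ 0 :=
      mul_nonpos_of_nonneg_of_nonpos (sub_nonneg.2 t.2.2) hn.1
    have h3 : (t : ℝ) * y.coord v ≤ 0 := mul_nonpos_of_nonneg_of_nonpos t.2.1 h1
    linarith
  · left
    rwa [mix, dif_neg hc] at h

/-- Compactness of `T` confines both families to finitely many vertices, and there continuity in the
union topology can be checked on coordinates. -/
theorem continuous_mix {T : Type*} [TopologicalSpace T] [CompactSpace T]
    {x y : T → Realization K} {t : T → unitInterval} (hx : Continuous x) (hy : Continuous y)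
    (ht : Continuous t) (h : ∀ s, t s = 0 ∨ Compatible (x s) (y s)) :
    Continuous fun s => mix (x s) (y s) (t s) := by
  refine continuous_of_coord
    ((finite_iUnion_support_range hx).union (finite_iUnion_support_range hy)) (fun s v hv => ?_)
    fun v => ?_
  · rcases mem_support_mix hv with h | h
    · exact Or.inl (Set.mem_iUnion.2 ⟨s, h⟩)
    · exact Or.inr (Set.mem_iUnion.2 ⟨s, h.2⟩)
  · simp only [mix_coord_apply (h _)]
    have h1 := (continuous_coordinate v).comp hx
    have h2 := (continuous_coordinate v).comp hy
    exact ((continuous_const.sub (continuous_subtype_val.comp ht)).mul h1).add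
      ((continuous_subtype_val.comp ht).mul h2)

end Mix

/-! ### Radial coordinates on the cube -/

section CubeGeometry

variable {N : Type*}

/-- Scaling of the cube by the factor `k` about its centre, followed by the coordinatewise
retraction onto the cube. -/
def cubeScale (k : ℝ) (y : N → unitInterval) : N → unitInterval :=
  fun i => Set.projIcc 0 1 zero_le_one (1 / 2 + k * ((y i : ℝ) - 1 / 2))

theorem continuous_cubeScale :
    Continuous fun q : ℝ × (N → unitInterval) => cubeScale q.1 q.2 := by
  refine continuous_pi fun i => continuous_projIcc.comp ?_
  fun_prop

@[simp]
theorem cubeScale_one (y : N → unitInterval) : cubeScale 1 y = y := by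
  funext i
  have : 1 / 2 + 1 * ((y i : ℝ) - 1 / 2) = y i := by ring
  rw [cubeScale, this, Set.projIcc_val]

variable [Fintype N]

/-- The distance from the centre of the cube in the maximum norm, normalized to be `1` on the
boundary. -/
def cubeRadius (y : N → unitInterval) : ℝ :=
  2 * dist y fun _ => (⟨1 / 2, by norm_num, by norm_num⟩ : unitInterval)

theorem continuous_cubeRadius : Continuous (cubeRadius : (N → unitInterval) → ℝ) :=
  continuous_const.mul (continuous_id.dist continuous_const)

theorem cubeRadius_nonneg (y : N → unitInterval) : 0 ≤ cubeRadius y :=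
  mul_nonneg zero_le_two dist_nonneg

theorem cubeRadius_le_one (y : N → unitInterval) : cubeRadius y ≤ 1 := by
  have : dist y (fun _ => (⟨1 / 2, by norm_num, by norm_num⟩ : unitInterval)) ≤ 1 / 2 := by
    rw [dist_pi_le_iff (by norm_num)]
    intro i
    rw [Subtype.dist_eq, Real.dist_eq, abs_le]
    have h0 := (y i).2.1
    have h1 := (y i).2.2
    constructor <;> simp only <;> linarith
  rw [cubeRadius]
  linarith

theorem cubeRadius_of_mem_boundary {y : N → unitInterval} (hy : y ∈ Cube.boundary N) :
    cubeRadius y = 1 := by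
  refine le_antisymm (cubeRadius_le_one y) ?_
  obtain ⟨i, hi⟩ := hy
  have := dist_le_pi_dist y (fun _ => (⟨1 / 2, by norm_num, by norm_num⟩ : unitInterval)) i
  have h2 : dist (y i) (⟨1 / 2, by norm_num, by norm_num⟩ : unitInterval) = 1 / 2 := by
    rw [Subtype.dist_eq, Real.dist_eq]
    rcases hi with h | h <;> rw [h] <;> norm_num
  rw [cubeRadius]
  linarith

/-- If no scaled coordinate is cut off at `0` or `1`, all coordinates of `y` are closer than `1 / (2
* k)` to the centre, so the radius is below `1 / k`. For empty `N` the radius is `0` and the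
boundary is empty, in accordance with this. -/
theorem cubeScale_mem_boundary {k : ℝ} {y : N → unitInterval} (h : 1 ≤ k * cubeRadius y) :
    cubeScale k y ∈ Cube.boundary N := by
  by_contra hn
  have hk : 0 < k := by
    by_contra! hk
    have := mul_nonpos_of_nonpos_of_nonneg hk (cubeRadius_nonneg y)
    linarith
  have h1 : dist y (fun _ => (⟨1 / 2, by norm_num, by norm_num⟩ : unitInterval)) < 1 / (2 * k) := by
    rw [dist_pi_lt_iff (by positivity)]
    intro i
    have h0 : ¬ (1 / 2 + k * ((y i : ℝ) - 1 / 2) ≤ 0) := fun hle =>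
      hn ⟨i, Or.inl (Set.projIcc_of_le_left _ hle)⟩
    have h1 : ¬ (1 ≤ 1 / 2 + k * ((y i : ℝ) - 1 / 2)) := fun hle =>
      hn ⟨i, Or.inr (Set.projIcc_of_right_le _ hle)⟩
    push Not at h0 h1
    rw [Subtype.dist_eq, Real.dist_eq, lt_div_iff₀ (by positivity)]
    have h2 : |((y i : ℝ) - 1 / 2)| * (2 * k) = 2 * |k * ((y i : ℝ) - 1 / 2)| := by
      rw [abs_mul, abs_of_pos hk]
      ring
    rw [h2]
    have : |k * ((y i : ℝ) - 1 / 2)| < 1 / 2 := abs_lt.2 ⟨by linarith, by linarith⟩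
    linarith
  rw [lt_div_iff₀ (by positivity)] at h1
  rw [cubeRadius] at h
  linarith

theorem mem_boundary_of_cubeRadius {y : N → unitInterval} (h : cubeRadius y = 1) :
    y ∈ Cube.boundary N := by
  rw [← cubeScale_one y]
  exact cubeScale_mem_boundary (by rw [h, one_mul])

variable {A : Type*}

open Classical in
/-- The map `G`, rescaled to the cube of radius `1 / k`, extended radially by `δ`. -/
def radialGlue (k : ℝ) (G : (N → unitInterval) → A) (δ : ℝ → A) (y : N → unitInterval) : A :=
  if k * cubeRadius y ≤ 1 then G (cubeScale k y) else δ (k * cubeRadius y - 1)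

theorem radialGlue_one (G : (N → unitInterval) → A) (δ : ℝ → A) (y : N → unitInterval) :
    radialGlue 1 G δ y = G y := by
  rw [radialGlue, if_pos (by rw [one_mul]; exact cubeRadius_le_one y), cubeScale_one]

theorem radialGlue_boundary {k : ℝ} (hk : 1 ≤ k) {G : (N → unitInterval) → A} {δ : ℝ → A}
    (h : ∀ z ∈ Cube.boundary N, G z = δ 0) {y : N → unitInterval} (hy : y ∈ Cube.boundary N) :
    radialGlue k G δ y = δ (k - 1) := by
  rw [radialGlue, cubeRadius_of_mem_boundary hy, mul_one]
  split_ifs with h1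
  · obtain rfl : k = 1 := le_antisymm h1 hk
    rw [cubeScale_one, h y hy, sub_self]
  · rfl

theorem continuous_radialGlue [TopologicalSpace A] {T : Type*} [TopologicalSpace T] {k : T → ℝ}
    {y : T → N → unitInterval} {G : T → (N → unitInterval) → A} {δ : T → ℝ → A}
    (hk : Continuous k) (hy : Continuous y)
    (hG : Continuous fun q : T × (N → unitInterval) => G q.1 q.2)
    (hδ : Continuous fun q : T × ℝ => δ q.1 q.2)
    (h : ∀ t, ∀ z ∈ Cube.boundary N, G t z = δ t 0) :
    Continuous fun t => radialGlue (k t) (G t) (δ t) (y t) := by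
  have hr : Continuous fun t => k t * cubeRadius (y t) := hk.mul (continuous_cubeRadius.comp hy)
  refine Continuous.if_le (hG.comp (continuous_id.prodMk (continuous_cubeScale.comp
    (hk.prodMk hy)))) (hδ.comp (continuous_id.prodMk (hr.sub continuous_const))) hr
    continuous_const fun t ht => ?_
  have ht' : k t * cubeRadius (y t) = 1 := ht
  simp only [ht', sub_self]
  exact h t _ (cubeScale_mem_boundary ht'.ge)

end CubeGeometry

/-! ### Change of base point -/

section BasePoint

variable {A : Type u} {B : Type v} [TopologicalSpace A] [TopologicalSpace B] {N : Type*}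

theorem HomotopicAlong.symm {a b : A} {γ : Path a b} {p : Ω^ N A a} {r : Ω^ N A b}
    (h : HomotopicAlong γ p r) : HomotopicAlong γ.symm r p := by
  obtain ⟨H, h0, h1, hb⟩ := h
  refine ⟨H.comp ⟨fun q => (unitInterval.symm q.1, q.2), by fun_prop⟩, fun y => ?_, fun y => ?_,
    fun s y hy => ?_⟩
  · simp [h1]
  · simp [h0]
  · simp [hb _ y hy]

theorem homotopicAlong_refl {a : A} (p : Ω^ N A a) : HomotopicAlong (Path.refl a) p p :=
  ⟨p.1.comp ContinuousMap.snd, fun _ => rfl, fun _ => rfl, fun _ y hy => p.2 y hy⟩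

/-- A homotopy of maps makes the images of a loop freely homotopic. -/
theorem homotopicAlong_of_homotopy {f g : C(A, B)} (H : f.Homotopy g) {a : A} {b c : B}
    (hf : f a = b) (hg : g a = c) (γ : Path b c) (hγ : ∀ s, γ s = H (s, a)) (p : Ω^ N A a) :
    HomotopicAlong γ (mapLoop f hf p) (mapLoop g hg p) := by
  refine ⟨H.toContinuousMap.comp ((ContinuousMap.id _).prodMap p.1), fun y => ?_, fun y => ?_,
    fun s y hy => ?_⟩
  · exact H.apply_zero _
  · exact H.apply_one _
  · rw [hγ]
    exact congrArg (fun z => H (s, z)) (p.2 y hy)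

theorem HomotopicAlong.map {a b : A} {γ : Path a b} {p : Ω^ N A a} {r : Ω^ N A b}
    (h : HomotopicAlong γ p r) (f : C(A, B)) :
    HomotopicAlong (γ.map f.continuous) (mapLoop f rfl p) (mapLoop f rfl r) := by
  obtain ⟨H, h0, h1, hb⟩ := h
  exact ⟨f.comp H, fun y => congrArg f (h0 y), fun y => congrArg f (h1 y),
    fun s y hy => congrArg f (hb s y hy)⟩

theorem homotopic_mapLoop {a : A} {b : B} (f : C(A, B)) (h : f a = b) {p r : Ω^ N A a}
    (H : GenLoop.Homotopic p r) : GenLoop.Homotopic (mapLoop f h p) (mapLoop f h r) :=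
  ContinuousMap.HomotopicRel.comp_continuousMap H f

/-- Loops which are joined by a homotopy, given as a function, constant on the boundary. -/
theorem homotopic_of_family {a : A} {p r : Ω^ N A a} (H : unitInterval × (N → unitInterval) → A)
    (hc : Continuous H) (h0 : ∀ y, H (0, y) = p y) (h1 : ∀ y, H (1, y) = r y)
    (hb : ∀ s, ∀ y ∈ Cube.boundary N, H (s, y) = a) : GenLoop.Homotopic p r :=
  ⟨{ toFun := H
     continuous_toFun := hc
     map_zero_left := h0
     map_one_left := h1
     prop' := fun s y hy => (hb s y hy).trans (p.2 y hy).symm }⟩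

variable [Fintype N]

/-- The transport of the loop `p` along the path `γ`: the loop `p` on the cube of half the size,
surrounded by a collar on which the map is `γ` in the radial direction. -/
def transport {a b : A} (γ : Path a b) (p : Ω^ N A a) : Ω^ N A b :=
  ⟨⟨radialGlue 2 p γ.extend, continuous_radialGlue (T := N → unitInterval) continuous_const
      continuous_id (p.1.continuous.comp continuous_snd) (γ.continuous_extend.comp continuous_snd)
      fun _ z hz => (p.2 z hz).trans γ.extend_zero.symm⟩, fun y hy => by
    have := radialGlue_boundary (one_le_two (α := ℝ)) (G := p) (δ := γ.extend)
      (fun z hz => (p.2 z hz).trans γ.extend_zero.symm) hy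
    refine this.trans ?_
    norm_num⟩

theorem transport_apply {a b : A} (γ : Path a b) (p : Ω^ N A a) (y : N → unitInterval) :
    transport γ p y = radialGlue 2 p γ.extend y := rfl

/-- A loop so transported is constant for radius at least `1 / 2`. This open collar around the
boundary is the room needed to correct an approximation to a based loop. -/
theorem transport_refl_apply {a : A} (p : Ω^ N A a) (y : N → unitInterval) :
    transport (Path.refl a) p y = p (cubeScale 2 y) := by
  rw [transport_apply, radialGlue]
  split_ifs with h
  · rfl
  · refine Eq.trans ?_ (p.2 _ (cubeScale_mem_boundary (not_le.1 h).le)).symm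
    simp

theorem map_transport {a b : A} (f : C(A, B)) (γ : Path a b) (p : Ω^ N A a)
    (y : N → unitInterval) :
    f (transport γ p y) = radialGlue 2 (fun z => f (p z)) (fun t => f (γ.extend t)) y := by
  rw [transport_apply, radialGlue, radialGlue]
  split_ifs <;> rfl

/-- The scaling factor grows from `1` to `2`; at time `s` the collar has swept out the part of `γ`
up to `s`. -/
theorem homotopicAlong_transport {a b : A} (γ : Path a b) (p : Ω^ N A a) :
    HomotopicAlong γ p (transport γ p) := by
  have hb : ∀ z ∈ Cube.boundary N, p z = γ.extend 0 := fun z hz =>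
    (p.2 z hz).trans γ.extend_zero.symm
  refine ⟨⟨fun q => radialGlue (1 + (q.1 : ℝ)) p γ.extend q.2, continuous_radialGlue
    (by fun_prop) continuous_snd (p.1.continuous.comp continuous_snd)
    (γ.continuous_extend.comp continuous_snd) fun _ => hb⟩, fun y => ?_, fun y => ?_,
    fun s y hy => ?_⟩
  · change radialGlue (1 + ((0 : unitInterval) : ℝ)) _ _ _ = _
    rw [Set.Icc.coe_zero, add_zero, radialGlue_one]
  · change radialGlue (1 + ((1 : unitInterval) : ℝ)) _ _ _ = _
    rw [Set.Icc.coe_one, one_add_one_eq_two]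
    rfl
  · refine (radialGlue_boundary (by linarith [s.2.1]) hb hy).trans ?_
    rw [add_sub_cancel_left, Path.extend_apply _ s.2]

/-- The homotopy `H` is run backwards. At time `s` the shrunk map is `H (1 - s, ·)`, and the collar
carries the remaining part of `γ`, from `1 - s` to `1`, so the boundary stays at `b`. -/
theorem HomotopicAlong.homotopic_transport {a b : A} {γ : Path a b} {p : Ω^ N A a} {r : Ω^ N A b}
    (h : HomotopicAlong γ p r) : GenLoop.Homotopic r (transport γ p) := by
  obtain ⟨H, h0, h1, hb⟩ := h
  have hag : ∀ q : unitInterval × (N → unitInterval), ∀ z ∈ Cube.boundary N,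
      H (unitInterval.symm q.1, z) = γ.extend ((unitInterval.symm q.1 : ℝ) + 0) := fun q z hz => by
    rw [hb _ z hz, add_zero, Path.extend_apply _ (unitInterval.symm q.1).2]
  refine homotopic_of_family (fun q => radialGlue (1 + (q.1 : ℝ))
    (fun z => H (unitInterval.symm q.1, z))
    (fun t => γ.extend ((unitInterval.symm q.1 : ℝ) + t)) q.2) ?_ (fun y => ?_) (fun y => ?_)
    fun s y hy => ?_
  · refine continuous_radialGlue (by fun_prop) continuous_snd (by fun_prop) ?_ hag
    exact γ.continuous_extend.comp (by fun_prop)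
  · simp only [Set.Icc.coe_zero, add_zero, radialGlue_one, unitInterval.symm_zero, h1]
  · simp only [Set.Icc.coe_one, one_add_one_eq_two, unitInterval.symm_one, h0,
      Set.Icc.coe_zero, zero_add]
    rfl
  · refine (radialGlue_boundary (by linarith [s.2.1]) (hag (s, y)) hy).trans ?_
    have : ((unitInterval.symm s : unitInterval) : ℝ) + (1 + (s : ℝ) - 1) = 1 := by
      rw [unitInterval.coe_symm_eq]
      ring
    rw [this, Path.extend_one]

/-- A homotopy relative to the boundary can be run at infinite speed near the boundary. -/
theorem continuous_fast_homotopy {p r : C(N → unitInterval, A)}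
    (R : p.HomotopyRel r (Cube.boundary N)) :
    Continuous fun q : ℝ × (N → unitInterval) =>
      R (Set.projIcc 0 1 zero_le_one (q.1 / (1 - cubeRadius q.2)), q.2) := by
  rw [continuous_iff_continuousAt]
  rintro ⟨v, y⟩
  have hr : ContinuousAt (fun q : ℝ × (N → unitInterval) => 1 - cubeRadius q.2) (v, y) :=
    (continuous_const.sub (continuous_cubeRadius.comp continuous_snd)).continuousAt
  by_cases hy : cubeRadius y = 1
  · have hyb := mem_boundary_of_cubeRadius hy
    -- At a boundary point `R` does not depend on time. As the time interval is compact, `R` stays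
    -- in the open set for all times at once over a neighbourhood of `y`, so the behaviour of the
    -- quotient does not matter.
    let c : C(N → unitInterval, C(unitInterval, A)) :=
      (R.toContinuousMap.comp ⟨Prod.swap, continuous_swap⟩).curry
    intro O hO
    have hc : ∀ s, R (s, y) = p y := fun s => R.eq_fst s hyb
    rw [Filter.mem_map]
    simp only [hc] at hO
    obtain ⟨O', hO', hopen, hmem⟩ := mem_nhds_iff.1 hO
    have h1 : {g : C(unitInterval, A) | Set.MapsTo g Set.univ O'} ∈ 𝓝 (c y) :=
      (ContinuousMap.isOpen_setOfPred_mapsTo isCompact_univ hopen).mem_nhds fun s _ => by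
        change R (s, y) ∈ O'
        rwa [hc]
    have h2 := (c.continuous.comp (continuous_snd (X := ℝ))).continuousAt (x := (v, y)) h1
    filter_upwards [h2] with q hq
    exact hO' (hq (Set.mem_univ _))
  · have hne : 1 - cubeRadius y ≠ 0 := sub_ne_zero.2 (Ne.symm hy)
    refine R.continuous.continuousAt.comp (ContinuousAt.prodMk ?_ continuousAt_snd)
    exact continuous_projIcc.continuousAt.comp (continuousAt_fst.div hr hne)

/-- An ordinary concatenation would reparametrize `γ` on the boundary. At radius `ρ`, therefore, `H`
runs during `[0, (1 + ρ) / 2]` and `R` in the time left. On the boundary `H` takes the whole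
interval and the path there is exactly `γ`. -/
theorem HomotopicAlong.trans_homotopic {a b : A} {γ : Path a b} {p : Ω^ N A a} {r r' : Ω^ N A b}
    (h : HomotopicAlong γ p r) (h' : GenLoop.Homotopic r r') : HomotopicAlong γ p r' := by
  classical
  obtain ⟨H, h0, h1, hb⟩ := h
  obtain ⟨R⟩ := h'
  have hρ : ∀ y : N → unitInterval, (1 : ℝ) + cubeRadius y ≠ 0 := fun y => by
    linarith [cubeRadius_nonneg y]
  refine ⟨⟨fun q => if 2 * (q.1 : ℝ) ≤ 1 + cubeRadius q.2 then
      H (Set.projIcc 0 1 zero_le_one (2 * (q.1 : ℝ) / (1 + cubeRadius q.2)), q.2) else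
      R (Set.projIcc 0 1 zero_le_one ((2 * (q.1 : ℝ) - 1 - cubeRadius q.2) /
        (1 - cubeRadius q.2)), q.2), ?_⟩, fun y => ?_, fun y => ?_, fun s y hy => ?_⟩
  · have hc : Continuous fun q : unitInterval × (N → unitInterval) => cubeRadius q.2 :=
      continuous_cubeRadius.comp continuous_snd
    refine Continuous.if_le ?_ ?_ (by fun_prop) (by fun_prop) fun q hq => ?_
    · refine H.continuous.comp (Continuous.prodMk ?_ continuous_snd)
      exact continuous_projIcc.comp (Continuous.div (by fun_prop) (by fun_prop) fun q => hρ _)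
    · exact (continuous_fast_homotopy R).comp
        (g := fun q : ℝ × (N → unitInterval) =>
          R (Set.projIcc 0 1 zero_le_one (q.1 / (1 - cubeRadius q.2)), q.2))
        (f := fun q : unitInterval × (N → unitInterval) =>
          (2 * (q.1 : ℝ) - 1 - cubeRadius q.2, q.2)) (by fun_prop)
    · rw [hq, div_self (hρ _), add_sub_cancel_left, sub_self, zero_div, Set.projIcc_left,
        Set.projIcc_right]
      exact (h1 _).trans (R.apply_zero _).symm
  · simp only [ContinuousMap.coe_mk, Set.Icc.coe_zero, mul_zero, zero_div]
    rw [if_pos (by linarith [cubeRadius_nonneg y]), Set.projIcc_left]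
    exact h0 y
  · simp only [ContinuousMap.coe_mk, Set.Icc.coe_one, mul_one]
    split_ifs with h
    · have hy : cubeRadius y = 1 := le_antisymm (cubeRadius_le_one y) (by linarith)
      have hyb := mem_boundary_of_cubeRadius hy
      rw [hy, one_add_one_eq_two, div_self two_ne_zero, Set.projIcc_right]
      exact (h1 y).trans ((r.2 y hyb).trans (r'.2 y hyb).symm)
    · have : (2 - 1 - cubeRadius y) / (1 - cubeRadius y) = 1 := by
        have : 1 - cubeRadius y ≠ 0 := fun h' => h (by linarith)
        rw [div_eq_one_iff_eq this]
        ring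
      rw [this, Set.projIcc_right]
      exact R.apply_one y
  · simp only [ContinuousMap.coe_mk]
    rw [cubeRadius_of_mem_boundary hy, if_pos (by linarith [s.2.2]), one_add_one_eq_two,
      mul_div_cancel_left₀ _ two_ne_zero, Set.projIcc_val, hb s y hy]

/-- Free homotopy along `γ` is thus the graph of a map on homotopy classes, the change of base
point. -/
theorem homotopicAlong_iff {a b : A} {γ : Path a b} {p : Ω^ N A a} {r : Ω^ N A b} :
    HomotopicAlong γ p r ↔ GenLoop.Homotopic (transport γ p) r :=
  ⟨fun h => h.homotopic_transport.symm,
    fun h => (homotopicAlong_transport γ p).trans_homotopic h⟩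

theorem HomotopicAlong.unique {a b : A} {γ : Path a b} {p : Ω^ N A a} {r r' : Ω^ N A b}
    (h : HomotopicAlong γ p r) (h' : HomotopicAlong γ p r') : GenLoop.Homotopic r r' :=
  h.homotopic_transport.trans h'.homotopic_transport.symm

theorem HomotopicAlong.homotopic_trans {a b : A} {γ : Path a b} {p p' : Ω^ N A a} {r : Ω^ N A b}
    (h' : GenLoop.Homotopic p p') (h : HomotopicAlong γ p' r) : HomotopicAlong γ p r := by
  have := (h.symm.trans_homotopic h'.symm).symm
  rwa [Path.symm_symm] at this

/-- Loops are homotopic if and only if their translates along a path are. -/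
theorem HomotopicAlong.homotopic_iff {a b : A} {γ : Path a b} {p p' : Ω^ N A a}
    {r r' : Ω^ N A b} (h : HomotopicAlong γ p r) (h' : HomotopicAlong γ p' r') :
    GenLoop.Homotopic p p' ↔ GenLoop.Homotopic r r' :=
  ⟨fun hp => h.unique (h'.homotopic_trans hp),
    fun hr => (h.trans_homotopic hr).symm.unique h'.symm⟩

theorem homotopic_shrink {a : A} (p : Ω^ N A a) :
    GenLoop.Homotopic p (transport (Path.refl a) p) :=
  (homotopicAlong_refl p).homotopic_transport

end BasePoint

/-! ### Maps with pointwise smaller supports -/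

section SupportLE

variable {V : Type u} {W : Type v} {K : AbstractSimplicialComplex V}
  {L : AbstractSimplicialComplex W}

/-- Pointwise, `φ` lies in the closed simplex spanned by `ψ`. -/
def SupportLE (φ ψ : C(Realization K, Realization L)) : Prop :=
  ∀ x, (φ x).coord.support ⊆ (ψ x).coord.support

theorem SupportLE.refl (φ : C(Realization K, Realization L)) : SupportLE φ φ :=
  fun _ => Finset.Subset.refl _

theorem SupportLE.compatible {φ ψ : C(Realization K, Realization L)} (h : SupportLE φ ψ)
    (x : Realization K) : Compatible (φ x) (ψ x) :=
  ⟨_, (ψ x).support_mem, h x, Finset.Subset.refl _⟩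

/-- The homotopy is built on the product with `|K|`, which is compact so that `continuous_mix`
applies, and then curried. -/
theorem exists_linear_homotopy [CompactSpace (Realization K)] {T : Type*} [TopologicalSpace T]
    [CompactSpace T] (φ ψ : C(T, C(Realization K, Realization L)))
    (h : ∀ t, SupportLE (φ t) (ψ t)) :
    ∃ H : C(unitInterval × T, C(Realization K, Realization L)),
      ∀ s t x, H (s, t) x = mix (φ t x) (ψ t x) s := by
  have hφ : Continuous fun q : T × Realization K => φ q.1 q.2 :=
    ContinuousMap.continuous_uncurry_of_continuous φ
  have hψ : Continuous fun q : T × Realization K => ψ q.1 q.2 :=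
    ContinuousMap.continuous_uncurry_of_continuous ψ
  let F : C((unitInterval × T) × Realization K, Realization L) :=
    ⟨fun q => mix (φ q.1.2 q.2) (ψ q.1.2 q.2) q.1.1, continuous_mix
      (hφ.comp (f := fun q : (unitInterval × T) × Realization K => (q.1.2, q.2)) (by fun_prop))
      (hψ.comp (f := fun q : (unitInterval × T) × Realization K => (q.1.2, q.2)) (by fun_prop))
      (by fun_prop) fun q => Or.inr ((h _).compatible _)⟩
  exact ⟨F.curry, fun _ _ _ => rfl⟩

theorem homotopic_of_supportLE [CompactSpace (Realization K)] {N : Type*}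
    {a : C(Realization K, Realization L)} {p r : Ω^ N C(Realization K, Realization L) a}
    (h : ∀ y, SupportLE (p y) (r y)) : GenLoop.Homotopic p r := by
  obtain ⟨H, hH⟩ := exists_linear_homotopy p.1 r.1 h
  refine homotopic_of_family H H.continuous (fun y => ?_) (fun y => ?_) fun s y hy => ?_
  · exact ContinuousMap.ext fun x => (hH 0 y x).trans (mix_zero _ _)
  · exact ContinuousMap.ext fun x => (hH 1 y x).trans (mix_one ((h y).compatible x))
  · refine ContinuousMap.ext fun x => (hH s y x).trans ?_
    rw [p.2 y hy, r.2 y hy, mix_self]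

/-! ### Supports of values of `Γ`, and the standard metric. -/

/-- All coefficients are nonnegative, so nothing cancels in the double sum. -/
theorem mem_support_gamma {a : Realization (contiguityComplex K L)} {x : Realization K} {w : W} :
    w ∈ (gamma K L a x).coord.support ↔
      ∃ f ∈ a.coord.support, ∃ v ∈ x.coord.support, f.toFun v = w := by
  classical
  constructor
  · intro h
    simpa using gammaCoord_support a x (Finset.Subset.refl _) (Finset.Subset.refl _) h
  · rintro ⟨f, hf, v, hv, rfl⟩
    rw [mem_support_iff_pos] at hf hv ⊢
    change 0 < gammaCoord a x (f.toFun v)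
    rw [gammaCoord_eq a x (Finset.Subset.refl _) (Finset.Subset.refl _), Finsupp.finsetSum_apply]
    have hnn : ∀ f' v', 0 ≤ Finsupp.single (SimplicialMap.toFun f' v') (a.coord f' * x.coord v')
        (f.toFun v) := fun f' v' => by
      rw [Finsupp.single_apply]
      split_ifs
      exacts [mul_nonneg (a.nonneg _) (x.nonneg _), le_rfl]
    refine Finset.sum_pos' (fun f' _ => ?_) ⟨f, mem_support_iff_pos.2 hf, ?_⟩
    · rw [Finsupp.finsetSum_apply]
      exact Finset.sum_nonneg fun v' _ => hnn f' v'
    · rw [Finsupp.finsetSum_apply]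
      refine Finset.sum_pos' (fun v' _ => hnn f v') ⟨v, mem_support_iff_pos.2 hv, ?_⟩
      rw [Finsupp.single_eq_same]
      exact mul_pos hf hv

@[simp]
theorem support_vertex (v : V) : (Realization.vertex K v).coord.support = {v} :=
  Finsupp.support_single _ one_ne_zero

theorem abs_sub_le_standardDist (x y : Realization K) (v : V) :
    |x.coord v - y.coord v| ≤ standardDist x y := by
  refine Real.abs_le_sqrt ?_
  by_cases hv : v ∈ (x.coord - y.coord).support
  · exact Finset.single_le_sum (f := fun v => (x.coord - y.coord) v ^ 2)
      (fun i _ => sq_nonneg _) hv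
  · have h0 : x.coord v - y.coord v = 0 := Finsupp.notMem_support_iff.1 hv
    rw [h0]
    rw [sq, mul_zero]
    exact Finset.sum_nonneg fun i _ => sq_nonneg ((x.coord - y.coord) i)

theorem Subdivision.standardDist_le_mesh {V' : Type*} {K' : AbstractSimplicialComplex V'}
    (S : Subdivision K' K) {σ : Finset V'} (hσ : σ ∈ K') {x y : Realization K'}
    (hx : x ∈ closedSimplex K' σ) (hy : y ∈ closedSimplex K' σ) :
    ENNReal.ofReal (standardDist (S.homeo x) (S.homeo y)) ≤ S.mesh :=
  le_iSup₂_of_le σ hσ (le_iSup₂_of_le x hx (le_iSup₂_of_le y hy le_rfl))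

/-- Lebesgue's covering lemma for the standard metric of a finite complex, with the metric replaced
by the maximum metric of the barycentric coordinates. -/
theorem exists_lebesgue_number [Finite V] (𝒰 : Set (Set (Realization K)))
    (ho : ∀ U ∈ 𝒰, IsOpen U) (hc : ∀ x, ∃ U ∈ 𝒰, x ∈ U) :
    ∃ δ > 0, ∀ x : Realization K, ∃ U ∈ 𝒰, ∀ y : Realization K,
      (∀ v, |y.coord v - x.coord v| < δ) → y ∈ U := by
  have := Fintype.ofFinite V
  have := compactSpace_of_finite (K := K)
  let ι : Realization K → V → ℝ := fun x v => x.coord v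
  have hι : Topology.IsClosedEmbedding ι := continuous_coords.isClosedEmbedding coord_injective
  choose O hO hOU using fun U : 𝒰 => hι.isInducing.isOpen_iff.1 (ho U.1 U.2)
  obtain ⟨δ, hδ, h⟩ := lebesgue_number_lemma_of_metric (isCompact_range hι.continuous) hO (by
    rintro _ ⟨x, rfl⟩
    obtain ⟨U, hU, hx⟩ := hc x
    refine Set.mem_iUnion.2 ⟨⟨U, hU⟩, ?_⟩
    exact (hOU ⟨U, hU⟩).ge hx)
  refine ⟨δ, hδ, fun x => ?_⟩
  obtain ⟨U, hU⟩ := h (ι x) ⟨x, rfl⟩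
  refine ⟨U, U.2, fun y hy => ?_⟩
  rw [← hOU U]
  refine hU ?_
  rw [Metric.mem_ball, dist_pi_lt_iff hδ]
  intro v
  rw [Real.dist_eq]
  exact hy v

end SupportLE

namespace SubdivisionTower

variable {V : ℕ → Type u} {X : ∀ n, AbstractSimplicialComplex (V n)} {W : Type v}
  {Y : AbstractSimplicialComplex W}

/-! ### Fine towers -/

/-- Every open cover of `|X 0|` is refined by the closed stars of `X n`, for all large `n`. -/
def Fine (T : SubdivisionTower X) : Prop :=
  ∀ 𝒰 : Set (Set (Realization (X 0))), (∀ U ∈ 𝒰, IsOpen U) → (∀ x, ∃ U ∈ 𝒰, x ∈ U) →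
    ∃ n₀, ∀ n ≥ n₀, ∀ v : V n, ∃ U ∈ 𝒰,
      closure {z : Realization (X n) | 0 < z.coord v} ⊆ (T.toBase n).homeo ⁻¹' U

/-- A point of the open star of `v` lies in a common simplex with `v`, so the mesh bounds its
distance from `v` in `|X 0|`. A Lebesgue number of the cover then finishes the argument. -/
theorem fine_of_mesh [Finite (V 0)] (T : SubdivisionTower X)
    (h : Filter.Tendsto (fun n => (T.toBase n).mesh) Filter.atTop (𝓝 0)) : T.Fine := by
  intro 𝒰 ho hc
  obtain ⟨δ, hδ, hU⟩ := exists_lebesgue_number 𝒰 ho hc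
  -- The bound `δ / 2` leaves a margin: on the closed star only a weak inequality survives.
  have hev := h.eventually (gt_mem_nhds (ENNReal.ofReal_pos.2 (half_pos hδ)))
  obtain ⟨n₀, hn₀⟩ := Filter.eventually_atTop.1 hev
  refine ⟨n₀, fun n hn v => ?_⟩
  obtain ⟨U, hU𝒰, hball⟩ := hU ((T.toBase n).homeo (Realization.vertex _ v))
  refine ⟨U, hU𝒰, fun z hz => hball _ fun u => ?_⟩
  refine lt_of_le_of_lt ?_ (half_lt_self hδ)
  have hcl : IsClosed {z : Realization (X n) | |((T.toBase n).homeo z).coord u -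
      ((T.toBase n).homeo (Realization.vertex _ v)).coord u| ≤ δ / 2} := by
    refine isClosed_le (continuous_abs.comp (Continuous.sub ?_ continuous_const)) continuous_const
    exact (continuous_coordinate u).comp (T.toBase n).homeo.continuous
  refine closure_minimal (fun z hz => ?_) hcl hz
  have hv : v ∈ z.coord.support := mem_support_iff_pos.2 hz
  have hm := (T.toBase n).standardDist_le_mesh z.support_mem (x := z)
    (y := Realization.vertex _ v) (Finset.Subset.refl _) (by
      exact (support_vertex v).subset.trans (Finset.singleton_subset_iff.2 hv))
  have hlt := (ENNReal.ofReal_lt_ofReal_iff (half_pos hδ)).1 (hm.trans_lt (hn₀ n hn))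
  exact (abs_sub_le_standardDist _ _ u).trans hlt.le

theorem shift_toBase (T : SubdivisionTower X) (k : ℕ) : ∀ (m : ℕ) (z : Realization (X (k + m))),
    (T.toBase (k + m)).homeo z = (T.toBase k).homeo (((T.shift k).toBase m).homeo z)
  | 0, _ => rfl
  | m + 1, z => T.shift_toBase k m ((T.sub (k + m)).homeo z)

/-- Fineness is a condition on open covers, so it passes through the homeomorphism `|X k| ≅ |X 0|`.
No comparison of the standard metrics of the two complexes is needed. -/
theorem Fine.shift {T : SubdivisionTower X} (h : T.Fine) (k : ℕ) : (T.shift k).Fine := by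
  intro 𝒰 ho hc
  obtain ⟨n₀, hn₀⟩ := h ((fun U => (T.toBase k).homeo.symm ⁻¹' U) '' 𝒰)
    (by
      rintro _ ⟨U, hU, rfl⟩
      exact (ho U hU).preimage (T.toBase k).homeo.symm.continuous)
    (fun x => by
      obtain ⟨U, hU, hx⟩ := hc ((T.toBase k).homeo.symm x)
      exact ⟨_, ⟨U, hU, rfl⟩, hx⟩)
  refine ⟨n₀, fun m hm v => ?_⟩
  obtain ⟨_, ⟨U, hU, rfl⟩, hsub⟩ := hn₀ (k + m) (hm.trans (Nat.le_add_left _ _)) v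
  refine ⟨U, hU, fun z hz => ?_⟩
  have := hsub hz
  simp only [Set.mem_preimage, T.shift_toBase k m z, Homeomorph.symm_apply_apply] at this
  exact this

theorem compactSpace_level (T : SubdivisionTower X) [CompactSpace (Realization (X 0))] (n : ℕ) :
    CompactSpace (Realization (X n)) :=
  (T.toBase n).homeo.symm.compactSpace

/-! ### Points of the mapping complexes approximating a continuous map -/

/-- Pointwise, the map defined by `a` lies in the closed simplex spanned by `ψ`. -/
def Carried (T : SubdivisionTower X) {n : ℕ} (a : T.mapSpace Y n)
    (ψ : C(Realization (X 0), Realization Y)) : Prop :=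
  SupportLE (T.compare Y n a) ψ

/-- The right-hand side says that each `f` occurring in `a` is a simplicial approximation of `ψ` on
`|X n|`. -/
theorem carried_iff {T : SubdivisionTower X} {n : ℕ} {a : T.mapSpace Y n}
    {ψ : C(Realization (X 0), Realization Y)} :
    T.Carried a ψ ↔ ∀ f ∈ a.coord.support, ∀ (z : Realization (X n)), ∀ v ∈ z.coord.support,
      f.toFun v ∈ (ψ ((T.toBase n).homeo z)).coord.support := by
  constructor
  · intro h f hf z v hv
    refine h _ (mem_support_gamma.2 ⟨f, hf, v, ?_, rfl⟩)
    change v ∈ ((T.toBase n).homeo.symm ((T.toBase n).homeo z)).coord.support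
    rwa [Homeomorph.symm_apply_apply]
  · intro h x w hw
    obtain ⟨f, hf, v, hv, rfl⟩ := mem_support_gamma.1 hw
    have := h f hf _ v hv
    change f.toFun v ∈ (ψ ((T.toBase n).homeo ((T.toBase n).homeo.symm x))).coord.support at this
    rwa [Homeomorph.apply_symm_apply] at this

/-- A simplicial approximation composed with the approximation `T.map n` of the subdivision
homeomorphism is again one. -/
theorem Carried.transition {T : SubdivisionTower X} {n : ℕ} {a : T.mapSpace Y n}
    {ψ : C(Realization (X 0), Realization Y)} (h : T.Carried a ψ) :
    T.Carried (T.transition Y n a) ψ := by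
  rw [carried_iff] at h ⊢
  intro f' hf' z v hv
  obtain ⟨f, hf, rfl⟩ := (SimplicialMap.support_real _ _ _).1 hf'
  refine h f hf ((T.sub n).homeo z) _ ?_
  refine T.approx n z _ ((T.sub n).homeo z).support_mem rfl ?_
  exact (SimplicialMap.support_real _ _ _).2 ⟨v, hv, rfl⟩

theorem Carried.piece {T : SubdivisionTower X} {n : ℕ} {a : T.mapSpace Y n}
    {ψ : C(Realization (X 0), Realization Y)} (h : T.Carried a ψ) (t : unitInterval) :
    SupportLE (T.piece Y n (a, t)) ψ := by
  classical
  intro x w hw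
  have hw' : w ∈ (T.compare Y n a x).coord.support := by
    let z := (T.toBase n).homeo.symm x
    change w ∈ ((1 - (t : ℝ)) • (gamma (X n) Y a z).coord +
      (t : ℝ) • (gamma (X n) Y a ((T.map n).real ((T.sub n).homeo.symm z))).coord).support at hw
    rcases Finset.mem_union.1 (Finsupp.support_add hw) with hw | hw
    · exact Finsupp.support_smul hw
    · obtain ⟨f, hf, v, hv, rfl⟩ := mem_support_gamma.1 (Finsupp.support_smul hw)
      refine mem_support_gamma.2 ⟨f, hf, v, ?_, rfl⟩
      refine T.approx n _ _ z.support_mem ?_ hv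
      change ((T.sub n).homeo ((T.sub n).homeo.symm z)).coord.support = _
      rw [Homeomorph.apply_symm_apply]
  exact h x hw'

/-- Contiguity of approximations of the same map: at the barycentre of a simplex of `X n`, the
support of the value of `ψ` is a simplex of `Y` containing the images of all its vertices under all
these maps. -/
theorem face_of_carried {T : SubdivisionTower X} {n : ℕ} {s : Finset (SimplicialMap (X n) Y)}
    (hs : s.Nonempty) {ψ : C(Realization (X 0), Realization Y)}
    (h : ∀ f ∈ s, ∀ (z : Realization (X n)), ∀ v ∈ z.coord.support,
      f.toFun v ∈ (ψ ((T.toBase n).homeo z)).coord.support) :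
    s ∈ contiguityComplex (X n) Y := by
  classical
  refine ⟨hs, fun σ hσ => ?_⟩
  obtain ⟨z, rfl⟩ := exists_support_eq hσ
  refine mem_of_subset (ψ ((T.toBase n).homeo z)).support_mem ?_ (hs.image₂ (nonempty_of_mem hσ))
  rw [Finset.image₂_subset_iff]
  exact fun f hf v hv => h f hf z v hv

theorem Carried.compatible {T : SubdivisionTower X} {n : ℕ} {a b : T.mapSpace Y n}
    {ψ : C(Realization (X 0), Realization Y)} (ha : T.Carried a ψ) (hb : T.Carried b ψ) :
    Compatible a b := by
  classical
  refine ⟨a.coord.support ∪ b.coord.support, ?_, Finset.subset_union_left,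
    Finset.subset_union_right⟩
  refine face_of_carried (T := T) (ψ := ψ)
    ((nonempty_of_mem a.support_mem).mono Finset.subset_union_left) fun f hf => ?_
  rcases Finset.mem_union.1 hf with hf | hf
  exacts [carried_iff.1 ha f hf, carried_iff.1 hb f hf]

/-- Convexity of the set of carried points; `b` matters only if it has positive weight. -/
theorem Carried.mix {T : SubdivisionTower X} {n : ℕ} {a b : T.mapSpace Y n}
    {ψ : C(Realization (X 0), Realization Y)} {t : unitInterval} (ha : T.Carried a ψ)
    (hb : t ≠ 0 → T.Carried b ψ) : T.Carried (mix a b t) ψ := by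
  refine carried_iff.2 fun f hf => ?_
  rcases mem_support_mix hf with hf | ⟨ht, hf⟩
  exacts [carried_iff.1 ha f hf, carried_iff.1 (hb ht) f hf]

/-- The composite `A n → A (n + j)` of the transition maps. -/
def transitions (T : SubdivisionTower X) (Y : AbstractSimplicialComplex W) (n : ℕ) :
    ∀ j, C(T.mapSpace Y n, T.mapSpace Y (n + j))
  | 0 => ContinuousMap.id _
  | j + 1 => (T.transition Y (n + j)).comp (T.transitions Y n j)

theorem Carried.transitions {T : SubdivisionTower X} {n : ℕ} {a : T.mapSpace Y n}
    {ψ : C(Realization (X 0), Realization Y)} (h : T.Carried a ψ) :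
    ∀ j, T.Carried (T.transitions Y n j a) ψ
  | 0 => h
  | j + 1 => (h.transitions j).transition

/-- The simplicial approximation theorem, made locally uniform in `ψ`. The preimages of the open
stars of `Y` cover `|X 0|`, and `f v` is a vertex whose preimage contains the closed star of `v`.
The closed stars are compact and finite in number, so this persists in a compact-open neighbourhood
of `ψ`. -/
theorem exists_carried_nhds {T : SubdivisionTower X} (hT : T.Fine)
    [CompactSpace (Realization (X 0))] (ψ : C(Realization (X 0), Realization Y)) :
    ∃ n₀, ∃ O, IsOpen O ∧ ψ ∈ O ∧ ∀ n ≥ n₀, ∃ f : SimplicialMap (X n) Y,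
      ∀ ψ' ∈ O, T.Carried (Realization.vertex _ f) ψ' := by
  classical
  obtain ⟨n, hn⟩ := hT (Set.range fun w => {x | 0 < (ψ x).coord w})
    (by
      rintro _ ⟨w, rfl⟩
      exact isOpen_lt continuous_const ((continuous_coordinate w).comp ψ.continuous))
    (fun x => by
      obtain ⟨w, hw⟩ := nonempty_of_mem (ψ x).support_mem
      exact ⟨_, ⟨w, rfl⟩, mem_support_iff_pos.1 hw⟩)
  have hf : ∀ v : V n, ∃ w, closure {z : Realization (X n) | 0 < z.coord v} ⊆
      (T.toBase n).homeo ⁻¹' {x | 0 < (ψ x).coord w} := fun v => by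
    obtain ⟨_, ⟨w, rfl⟩, h⟩ := hn n le_rfl v
    exact ⟨w, h⟩
  choose f hf using hf
  have := T.compactSpace_level n
  have := finite_of_compactSpace (K := X n)
  let Z : V n → Set (Realization (X n)) := fun v => closure {z | 0 < z.coord v}
  let O : Set C(Realization (X 0), Realization Y) := ⋂ v, {ψ' |
    Set.MapsTo ψ' ((T.toBase n).homeo '' Z v) {y | 0 < y.coord (f v)}}
  have hO : IsOpen O := isOpen_iInter_of_finite fun v =>
    ContinuousMap.isOpen_setOfPred_mapsTo
      (isClosed_closure.isCompact.image (T.toBase n).homeo.continuous)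
      (isOpen_lt continuous_const (continuous_coordinate (f v)))
  let g : SimplicialMap (X n) Y := ⟨f, fun σ hσ => by
    obtain ⟨z, rfl⟩ := exists_support_eq hσ
    refine mem_of_subset (ψ ((T.toBase n).homeo z)).support_mem ?_
      ((nonempty_of_mem hσ).image _)
    rw [Finset.image_subset_iff]
    exact fun v hv => mem_support_iff_pos.2 (hf v (subset_closure (mem_support_iff_pos.1 hv)))⟩
  refine ⟨n, O, hO, Set.mem_iInter.2 fun v => ?_, fun m hm => ?_⟩
  · rintro _ ⟨z, hz, rfl⟩
    exact hf v hz
  · induction m, hm using Nat.le_induction with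
    | base =>
      refine ⟨g, fun ψ' hψ' => carried_iff.2 fun f' hf' z v hv => ?_⟩
      rw [support_vertex, Finset.mem_singleton] at hf'
      rw [hf', mem_support_iff_pos]
      exact Set.mem_iInter.1 hψ' v
        ⟨z, subset_closure (mem_support_iff_pos.1 hv), rfl⟩
    -- Composition with `T.map m` produces the approximation at the next level, with the same
    -- neighbourhood `O`.
    | succ m _ ih =>
      obtain ⟨g, hg⟩ := ih
      refine ⟨g.comp (T.map m), fun ψ' hψ' => ?_⟩
      have := (hg ψ' hψ').transition
      rwa [SubdivisionTower.transition, real_vertex] at this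

/-- Every compact family of continuous maps is approximated by a family of points of `A n`, for all
large `n`. -/
theorem exists_carried_family {T : SubdivisionTower X} (hT : T.Fine)
    [CompactSpace (Realization (X 0))] {P : Type*} [TopologicalSpace P] [CompactSpace P]
    [T2Space P] (φ : C(P, C(Realization (X 0), Realization Y))) :
    ∃ n₀, ∀ n ≥ n₀, ∃ β : C(P, T.mapSpace Y n), ∀ p, T.Carried (β p) (φ p) := by
  classical
  choose n₀ O hO hmem hf using fun p => exists_carried_nhds (T := T) hT (φ p)
  obtain ⟨t, ht⟩ := CompactSpace.elim_nhds_subcover (fun p => φ ⁻¹' O p)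
    fun p => ((hO p).preimage φ.continuous).mem_nhds (hmem p)
  refine ⟨t.sup n₀, fun n hn => ?_⟩
  choose g hg using fun p : t => hf p n ((Finset.le_sup p.2).trans hn)
  obtain ⟨ρ, hρ⟩ := PartitionOfUnity.exists_isSubordinate (s := (Set.univ : Set P))
    isClosed_univ (fun p : t => φ ⁻¹' O p) (fun p => (hO p).preimage φ.continuous) (by
      rw [← Set.top_eq_univ, ← ht]
      exact Set.iUnion₂_subset fun p hp => Set.subset_iUnion_of_subset ⟨p, hp⟩ subset_rfl)
  have hmem' : ∀ i p, ρ i p ≠ 0 → φ p ∈ O i := fun i p h =>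
    hρ i (subset_closure (Function.mem_support.2 h))
  have hsum : ∀ p, ∑ i, ρ i p = 1 := fun p => by
    rw [← finsum_eq_sum_of_fintype]
    exact ρ.sum_eq_one (Set.mem_univ p)
  -- The maps `g i`, averaged by the partition of unity. Those with non-zero weight at `p` all
  -- approximate `φ p`, hence span a simplex. They need not be distinct, so the coefficients of
  -- equal ones add up.
  let c : P → SimplicialMap (X n) Y →₀ ℝ := fun p => ∑ i, Finsupp.single (g i) (ρ i p)
  have hc : ∀ p f, c p f = ∑ i, if g i = f then ρ i p else 0 := fun p f => by
    simp only [c, Finsupp.finsetSum_apply, Finsupp.single_apply]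
  have hcs : ∀ p f, f ∈ (c p).support → ∃ i, g i = f ∧ ρ i p ≠ 0 := fun p f h => by
    rw [Finsupp.mem_support_iff, hc] at h
    obtain ⟨i, _, hi⟩ := Finset.exists_ne_zero_of_sum_ne_zero h
    by_cases hgi : g i = f
    · exact ⟨i, hgi, by simpa [hgi] using hi⟩
    · simp [hgi] at hi
  have hcar : ∀ p, ∀ f ∈ (c p).support, ∀ (z : Realization (X n)), ∀ v ∈ z.coord.support,
      f.toFun v ∈ (φ p ((T.toBase n).homeo z)).coord.support := fun p f h => by
    obtain ⟨i, rfl, hi⟩ := hcs p f h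
    exact carried_iff.1 (hg i _ (hmem' i p hi)) _ (by simp)
  have hdeg : ∀ p, ((c p).sum fun _ t => t) = 1 := fun p => by
    change (c p).degree = 1
    simp only [c, map_sum, Finsupp.degree_single, hsum]
  have hne : ∀ p, (c p).support.Nonempty := fun p => by
    rw [Finset.nonempty_iff_ne_empty]
    intro h
    have := hdeg p
    rw [Finsupp.sum, h] at this
    simp at this
  let β : P → T.mapSpace Y n := fun p =>
    { coord := c p
      nonneg := fun f => by
        rw [hc]
        refine Finset.sum_nonneg fun i _ => ?_
        split_ifs
        exacts [ρ.nonneg i p, le_rfl]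
      sum_eq_one := hdeg p
      support_mem := face_of_carried (hne p) (hcar p) }
  have hβ : Continuous β := by
    refine continuous_of_coord (Set.finite_range g) (fun p f hf => ?_) fun f => ?_
    · obtain ⟨i, rfl, _⟩ := hcs p f hf
      exact ⟨i, rfl⟩
    · change Continuous fun p => c p f
      simp only [hc]
      refine continuous_finsetSum _ fun i _ => ?_
      split_ifs
      exacts [(ρ i).continuous, continuous_const]
  exact ⟨⟨β, hβ⟩, fun p => carried_iff.2 (hcar p)⟩

/-- A family approximating `φ` can be changed to a prescribed one on a closed set, if the latter
approximates `φ` near this set. -/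
theorem exists_carried_modification {T : SubdivisionTower X} {n : ℕ} {P : Type*}
    [TopologicalSpace P] [CompactSpace P] [T2Space P]
    {φ : P → C(Realization (X 0), Realization Y)} {β α : C(P, T.mapSpace Y n)}
    (hβ : ∀ p, T.Carried (β p) (φ p)) {C U : Set P} (hC : IsClosed C) (hU : IsOpen U) (hCU : C ⊆ U)
    (hα : ∀ p ∈ U, T.Carried (α p) (φ p)) :
    ∃ β' : C(P, T.mapSpace Y n), (∀ p, T.Carried (β' p) (φ p)) ∧ (∀ p ∈ C, β' p = α p) ∧
      ∀ p, (p ∈ U → β p = α p) → β' p = β p := by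
  -- A Urysohn function moves from `β` off `U` to `α` on `C`. Where it is non-zero both are carried
  -- by `φ p`, so the segment exists and stays carried.
  obtain ⟨l, hl0, hl1, hl⟩ := exists_continuous_zero_one_of_isClosed hU.isClosed_compl hC
    (Set.disjoint_compl_left_iff_subset.2 hCU)
  let t : P → unitInterval := fun p => ⟨l p, hl p⟩
  have ht : Continuous t := l.continuous.subtype_mk _
  have ht0 : ∀ p, p ∉ U → t p = 0 := fun p hp => Subtype.ext (hl0 hp)
  have ht1 : ∀ p ∈ C, t p = 1 := fun p hp => Subtype.ext (hl1 hp)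
  have hcomp : ∀ p, t p = 0 ∨ Compatible (β p) (α p) := fun p => by
    by_cases hp : p ∈ U
    exacts [Or.inr ((hβ p).compatible (hα p hp)), Or.inl (ht0 p hp)]
  refine ⟨⟨fun p => mix (β p) (α p) (t p), continuous_mix β.continuous α.continuous ht hcomp⟩,
    fun p => (hβ p).mix fun hp => hα p ?_, fun p hp => ?_, fun p hp => ?_⟩
  · by_contra h
    exact hp (ht0 p h)
  · change mix (β p) (α p) (t p) = α p
    rw [ht1 p hp]
    exact mix_one ((hβ p).compatible (hα p (hCU hp)))
  · change mix (β p) (α p) (t p) = β p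
    by_cases h : p ∈ U
    · rw [← hp h, mix_self]
    · rw [ht0 p h, mix_zero]

end SubdivisionTower

namespace SubdivisionTower

variable {V : ℕ → Type u} {X : ∀ n, AbstractSimplicialComplex (V n)} {W : Type v}
  {Y : AbstractSimplicialComplex W}

/-! ### Loops in the mapping complexes -/

theorem isClosed_cubeBoundary {N : Type*} [Fintype N] : IsClosed (Cube.boundary N) := by
  have : Cube.boundary N = {y | cubeRadius y = 1} :=
    Set.ext fun y => ⟨cubeRadius_of_mem_boundary, mem_boundary_of_cubeRadius⟩
  rw [this]
  exact isClosed_eq continuous_cubeRadius continuous_const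

theorem isOpen_cubeCollar {N : Type*} [Fintype N] :
    IsOpen {y : N → unitInterval | 1 < 2 * cubeRadius y} :=
  isOpen_lt continuous_const (continuous_const.mul continuous_cubeRadius)

theorem cubeBoundary_subset_collar {N : Type*} [Fintype N] {y : N → unitInterval}
    (hy : y ∈ Cube.boundary N) : 1 < 2 * cubeRadius y := by
  rw [cubeRadius_of_mem_boundary hy]
  norm_num

/-- After shrinking, the loop equals `ψ` on a collar of the boundary. The constant family at `a` is
carried there, so it can be prescribed on the boundary. -/
theorem exists_carried_loop {T : SubdivisionTower X} (hT : T.Fine)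
    [CompactSpace (Realization (X 0))] {N : Type*} [Fintype N]
    {ψ : C(Realization (X 0), Realization Y)} (r : Ω^ N C(Realization (X 0), Realization Y) ψ) :
    ∃ n₀, ∀ n ≥ n₀, ∀ a : T.mapSpace Y n, T.Carried a ψ →
      ∃ p : Ω^ N (T.mapSpace Y n) a, ∀ y, T.Carried (p y) (transport (Path.refl ψ) r y) := by
  obtain ⟨n₀, h⟩ := exists_carried_family hT (transport (Path.refl ψ) r).1
  refine ⟨n₀, fun n hn a ha => ?_⟩
  obtain ⟨β, hβ⟩ := h n hn
  obtain ⟨β', hβ', hC, _⟩ := exists_carried_modification hβ (α := ContinuousMap.const _ a)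
    isClosed_cubeBoundary isOpen_cubeCollar (fun y => cubeBoundary_subset_collar) (fun y hy => by
      have : transport (Path.refl ψ) r y = ψ :=
        (transport_refl_apply r y).trans (r.2 _ (cubeScale_mem_boundary (le_of_lt hy)))
      exact this.symm ▸ ha)
  exact ⟨⟨β', hC⟩, hβ'⟩

/-- A homotopy between the images is approximated at a higher level, and the approximation is
corrected at both ends and on the boundary of the cube. The homotopy is first made stationary near
these sets, so that the prescribed values are carried near them. -/
theorem exists_homotopic_transitions {T : SubdivisionTower X} (hT : T.Fine)
    [CompactSpace (Realization (X 0))] {N : Type*} [Fintype N] {n : ℕ} {a : T.mapSpace Y n}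
    {p r : Ω^ N (T.mapSpace Y n) a}
    (h : GenLoop.Homotopic (mapLoop (T.compare Y n) rfl p) (mapLoop (T.compare Y n) rfl r)) :
    ∃ j, GenLoop.Homotopic (mapLoop (T.transitions Y n j) rfl p)
      (mapLoop (T.transitions Y n j) rfl r) := by
  obtain ⟨K⟩ := h
  let P := unitInterval × (N → unitInterval)
  have hcs : Continuous fun q : P => cubeScale 2 q.2 :=
    continuous_cubeScale.comp (continuous_const.prodMk continuous_snd)
  -- Stationary on the first and the last third of the interval; scaling by `2` does the same near
  -- the boundary of the cube.
  let τ : unitInterval → unitInterval := fun s => Set.projIcc 0 1 zero_le_one (3 * (s : ℝ) - 1)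
  have hτ : Continuous τ := continuous_projIcc.comp (by fun_prop)
  let φ : C(P, C(Realization (X 0), Realization Y)) := ⟨fun q => K (τ q.1, cubeScale 2 q.2),
    K.continuous.comp ((hτ.comp continuous_fst).prodMk hcs)⟩
  obtain ⟨j, hj⟩ := exists_carried_family hT φ
  -- Approximations exist at all levels from `j` on, in particular at level `n + j`, so `j` can also
  -- serve as the number of transitions.
  obtain ⟨β₀, hβ₀⟩ := hj (n + j) (Nat.le_add_left _ _)
  let tr := T.transitions Y n j
  let α (p : Ω^ N (T.mapSpace Y n) a) : C(P, T.mapSpace Y (n + j)) :=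
    ⟨fun q => tr (p (cubeScale 2 q.2)), tr.continuous.comp (p.1.continuous.comp hcs)⟩
  have hs : Continuous fun q : P => (q.1 : ℝ) := continuous_subtype_val.comp continuous_fst
  obtain ⟨β₁, hβ₁, hC₁, _⟩ := exists_carried_modification hβ₀ (α := α p)
    (C := {q : P | (q.1 : ℝ) = 0}) (U := {q : P | (q.1 : ℝ) < 1 / 3})
    (isClosed_eq hs continuous_const) (isOpen_lt hs continuous_const)
    (fun q hq => by
      change (q.1 : ℝ) < 1 / 3
      rw [show (q.1 : ℝ) = 0 from hq]
      norm_num)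
    (fun q (hq : (q.1 : ℝ) < 1 / 3) => by
      have h0 : τ q.1 = 0 := Set.projIcc_of_le_left _ (by linarith)
      have : φ q = T.compare Y n (p (cubeScale 2 q.2)) := by
        change K (τ q.1, cubeScale 2 q.2) = _
        rw [h0]
        exact K.apply_zero _
      rw [this]
      exact Carried.transitions (SupportLE.refl _) j)
  obtain ⟨β₂, hβ₂, hC₂, hU₂⟩ := exists_carried_modification hβ₁ (α := α r)
    (C := {q : P | (q.1 : ℝ) = 1}) (U := {q : P | 2 / 3 < (q.1 : ℝ)})
    (isClosed_eq hs continuous_const) (isOpen_lt continuous_const hs)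
    (fun q hq => by
      change 2 / 3 < (q.1 : ℝ)
      rw [show (q.1 : ℝ) = 1 from hq]
      norm_num)
    (fun q (hq : 2 / 3 < (q.1 : ℝ)) => by
      have h1 : τ q.1 = 1 := Set.projIcc_of_right_le _ (by linarith)
      have : φ q = T.compare Y n (r (cubeScale 2 q.2)) := by
        change K (τ q.1, cubeScale 2 q.2) = _
        rw [h1]
        exact K.apply_one _
      rw [this]
      exact Carried.transitions (SupportLE.refl _) j)
  obtain ⟨β₃, -, hC₃, hU₃⟩ := exists_carried_modification hβ₂ (α := ContinuousMap.const _ (tr a))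
    (isClosed_cubeBoundary.preimage continuous_snd) (isOpen_cubeCollar.preimage continuous_snd)
    (fun q => cubeBoundary_subset_collar) (fun q hq => by
      have : φ q = T.compare Y n a := by
        have hb := cubeScale_mem_boundary (le_of_lt hq)
        refine (K.eq_fst _ hb).trans (congrArg (T.compare Y n) (p.2 _ hb))
      rw [this]
      exact Carried.transitions (SupportLE.refl _) j)
  -- On the collar the scaled loop is at its base point. There the ends already agree with the
  -- constant `tr a`, and the last correction leaves them unchanged.
  have hend : ∀ (r : Ω^ N (T.mapSpace Y n) a) (q : P), β₂ q = α r q → β₃ q = α r q :=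
    fun r q h => (hU₃ q fun hq => h.trans
      (congrArg tr (r.2 _ (cubeScale_mem_boundary (le_of_lt hq))))).trans h
  have hmid : GenLoop.Homotopic (mapLoop tr rfl (transport (Path.refl a) p))
      (mapLoop tr rfl (transport (Path.refl a) r)) := by
    refine homotopic_of_family β₃ β₃.continuous (fun y => ?_) (fun y => ?_) fun s y hy =>
      hC₃ (s, y) hy
    · refine (hend p (0, y) ?_).trans (congrArg tr (transport_refl_apply p y)).symm
      refine (hU₂ (0, y) fun h => ?_).trans (hC₁ (0, y) rfl)
      have h' : (2 : ℝ) / 3 < 0 := h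
      norm_num at h'
    · exact (hend r (1, y) (hC₂ (1, y) rfl)).trans (congrArg tr (transport_refl_apply r y)).symm
  exact ⟨j, ((homotopic_mapLoop tr rfl (homotopic_shrink p)).trans hmid).trans
    (homotopic_mapLoop tr rfl (homotopic_shrink r)).symm⟩

end SubdivisionTower

/-! ### Telescopes -/

namespace Telescope

variable {A : ℕ → Type u} [∀ n, TopologicalSpace (A n)] (φ : ∀ n, C(A n, A (n + 1)))

/-- The map from the `n`-th piece to the telescope. -/
def mk (n : ℕ) : C(A n × unitInterval, Telescope φ) :=
  ⟨fun q => Quot.mk _ ⟨n, q⟩, continuous_quot_mk.comp continuous_sigmaMk⟩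

/-- The inclusion of `A n` into the telescope, at the start of the `n`-th piece. -/
def incl (n : ℕ) : C(A n, Telescope φ) :=
  (mk φ n).comp ⟨fun a => (a, 0), by fun_prop⟩

theorem mk_one (n : ℕ) (a : A n) : mk φ n (a, 1) = incl φ (n + 1) (φ n a) :=
  Quot.sound (Rel.glue n a)

variable {φ} in
theorem exists_eq_mk (z : Telescope φ) : ∃ n a t, z = mk φ n (a, t) := by
  obtain ⟨⟨n, a, t⟩, rfl⟩ := Quot.exists_rep z
  exact ⟨n, a, t, rfl⟩

/-- The projection of the telescope to the half-line. -/
def time : C(Telescope φ, ℝ) where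
  toFun := Quot.lift (fun p : Σ n, A n × unitInterval => (p.1 : ℝ) + (p.2.2 : ℝ)) (by
    rintro _ _ ⟨n, a⟩
    simp)
  continuous_toFun := continuous_quot_lift _ (continuous_sigma fun n =>
    (continuous_const (y := (n : ℝ))).add (continuous_subtype_val.comp continuous_snd))

theorem time_mk (n : ℕ) (a : A n) (t : unitInterval) : time φ (mk φ n (a, t)) = n + t := rfl

theorem time_incl (n : ℕ) (a : A n) : time φ (incl φ n a) = n := by
  change (n : ℝ) + ((0 : unitInterval) : ℝ) = n
  simp

theorem time_nonneg (z : Telescope φ) : 0 ≤ time φ z := by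
  obtain ⟨n, a, t, rfl⟩ := exists_eq_mk z
  rw [time_mk]
  exact add_nonneg n.cast_nonneg t.2.1

open Classical in
/-- The representative of a point of the telescope which is not at the end of its piece. -/
def normalForm : Telescope φ → Σ n, A n × unitInterval :=
  Quot.lift (fun p => if p.2.2 = 1 then ⟨p.1 + 1, (φ p.1 p.2.1, 0)⟩ else p) (by
    rintro _ _ ⟨n, a⟩
    simp)

theorem normalForm_incl (n : ℕ) (a : A n) : normalForm φ (incl φ n a) = ⟨n, (a, 0)⟩ :=
  if_neg zero_ne_one

/-- `normalForm` is well defined on the quotient and recovers `a`, which avoids describing the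
generated equivalence relation. -/
theorem incl_injective (n : ℕ) : Function.Injective (incl φ n) := fun a b h => by
  have := congrArg (normalForm φ) h
  rw [normalForm_incl, normalForm_incl] at this
  simpa using this

theorem eq_incl_of_time {n : ℕ} {z : Telescope φ} (h : time φ z = n) : ∃ a, incl φ n a = z := by
  obtain ⟨m, a, t, rfl⟩ := exists_eq_mk z
  rw [time_mk] at h
  rcases eq_or_ne t 1 with rfl | ht
  · have : m + 1 = n := by
      rw [Set.Icc.coe_one] at h
      exact_mod_cast h
    subst this
    exact ⟨φ m a, (mk_one φ m a).symm⟩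
  · have ht1 : (t : ℝ) < 1 := lt_of_le_of_ne t.2.2 fun h' => ht (Subtype.ext h')
    have h1 : (n : ℝ) < m + 1 := by linarith
    have h2 : (m : ℝ) ≤ n := by linarith [t.2.1]
    have : m = n := le_antisymm (by exact_mod_cast h2) (Nat.lt_succ_iff.1 (by exact_mod_cast h1))
    subst this
    have ht0 : t = 0 := Subtype.ext (by simpa using h)
    subst ht0
    exact ⟨a, rfl⟩

/-- Closedness is tested on each piece. The image of `C` meets only piece `n`, at its start, and
piece `n - 1` (if there is one), at its end, in the preimage of `C` under the transition map. The
embedding allows families at time `n` to be lifted continuously to `A n`. -/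
theorem isClosedEmbedding_incl (n : ℕ) : Topology.IsClosedEmbedding (incl φ n) := by
  refine Topology.IsClosedEmbedding.of_continuous_injective_isClosedMap (incl φ n).continuous
    (incl_injective φ n) fun C hC => ?_
  have hq : Topology.IsQuotientMap
      (Quot.mk (Rel φ) : (Σ n, A n × unitInterval) → Telescope φ) := isQuotientMap_quot_mk
  refine hq.isClosed_preimage.1 (isClosed_sigma_iff.2 ?_)
  intro m
  change IsClosed {q : A m × unitInterval | mk φ m q ∈ incl φ n '' C}
  by_cases h1 : m = n
  · subst h1
    have : {q : A m × unitInterval | mk φ m q ∈ incl φ m '' C} = {q | q.1 ∈ C ∧ q.2 = 0} := by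
      ext ⟨a, t⟩
      constructor
      · rintro ⟨c, hc, h⟩
        have ht : t = 0 := Subtype.ext (by
          have := congrArg (time φ) h
          rw [time_incl, time_mk] at this
          simpa using this)
        subst ht
        exact ⟨incl_injective φ m h ▸ hc, rfl⟩
      · rintro ⟨ha, ht⟩
        exact ⟨a, ha, by rw [show t = 0 from ht]; rfl⟩
    rw [this]
    exact (hC.preimage continuous_fst).inter (isClosed_eq continuous_snd continuous_const)
  by_cases h2 : m + 1 = n
  · subst h2
    have : {q : A m × unitInterval | mk φ m q ∈ incl φ (m + 1) '' C} =
        {q | φ m q.1 ∈ C ∧ q.2 = 1} := by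
      ext ⟨a, t⟩
      constructor
      · rintro ⟨c, hc, h⟩
        have ht : t = 1 := Subtype.ext (by
          have := congrArg (time φ) h
          rw [time_incl, time_mk] at this
          push_cast at this
          rw [Set.Icc.coe_one]
          linarith)
        subst ht
        rw [mk_one] at h
        exact ⟨incl_injective φ _ h ▸ hc, rfl⟩
      · rintro ⟨ha, ht⟩
        exact ⟨φ m a, ha, by rw [show t = 1 from ht, mk_one]⟩
    rw [this]
    exact (hC.preimage ((φ m).continuous.comp continuous_fst)).inter
      (isClosed_eq continuous_snd continuous_const)
  · have : {q : A m × unitInterval | mk φ m q ∈ incl φ n '' C} = ∅ := by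
      refine Set.eq_empty_of_forall_notMem ?_
      rintro ⟨a, t⟩ ⟨c, hc, h⟩
      have := congrArg (time φ) h
      rw [time_incl, time_mk] at this
      have hle : (m : ℝ) ≤ n := by linarith [t.2.1]
      have hle' : (n : ℝ) ≤ m + 1 := by linarith [t.2.2]
      have hle2 : m ≤ n := by exact_mod_cast hle
      have hle3 : n ≤ m + 1 := by exact_mod_cast hle'
      omega
    rw [this]
    exact isClosed_empty

theorem exists_lift {n : ℕ} {P : Type*} [TopologicalSpace P] (f : C(P, Telescope φ))
    (h : ∀ p, time φ (f p) = n) : ∃ g : C(P, A n), ∀ p, incl φ n (g p) = f p := by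
  choose g hg using fun p => eq_incl_of_time φ (h p)
  refine ⟨⟨g, (isClosedEmbedding_incl φ n).isInducing.continuous_iff.2 ?_⟩, hg⟩
  have : incl φ n ∘ g = f := funext hg
  rw [this]
  exact f.continuous

open Classical in
/-- The flow on a piece, as a function of the time parameter. -/
def pieceFlow (n : ℕ) (q : (A n × unitInterval) × unitInterval) : Telescope φ :=
  if (q.1.2 : ℝ) + q.2 ≤ 1 then
    mk φ n (q.1.1, Set.projIcc 0 1 zero_le_one ((q.1.2 : ℝ) + q.2)) else
    mk φ (n + 1) (φ n q.1.1, Set.projIcc 0 1 zero_le_one ((q.1.2 : ℝ) + q.2 - 1))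

theorem continuous_pieceFlow (n : ℕ) : Continuous (pieceFlow φ n) := by
  refine Continuous.if_le ?_ ?_ (by fun_prop) continuous_const fun q hq => ?_
  · refine (mk φ n).continuous.comp (Continuous.prodMk (by fun_prop) ?_)
    exact continuous_projIcc.comp (by fun_prop)
  · refine (mk φ (n + 1)).continuous.comp (Continuous.prodMk (by fun_prop) ?_)
    exact continuous_projIcc.comp (by fun_prop)
  · rw [hq, sub_self, Set.projIcc_left, Set.projIcc_right]
    exact mk_one φ n q.1.1

/-- The flow of the telescope in the direction of the half-line, for times in `[0, 1]`. -/
def flow : C(Telescope φ, C(unitInterval, Telescope φ)) where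
  -- Taking values in a space of paths lets continuity descend from the pieces, without asking
  -- whether the product of the quotient map with an interval is a quotient map.
  toFun := Quot.lift
    (fun p => ⟨fun s => pieceFlow φ p.1 (p.2, s),
      (continuous_pieceFlow φ p.1).comp (by fun_prop)⟩) (by
    rintro _ _ ⟨n, a⟩
    refine ContinuousMap.ext fun s => ?_
    change pieceFlow φ n ((a, 1), s) = pieceFlow φ (n + 1) ((φ n a, 0), s)
    have h2 : pieceFlow φ (n + 1) ((φ n a, 0), s) = mk φ (n + 1) (φ n a, s) := by
      rw [pieceFlow, if_pos (by simpa using s.2.2)]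
      simp
    rw [h2]
    rcases eq_or_ne s 0 with rfl | hs
    · rw [pieceFlow, if_pos (by simp)]
      simp only [Set.Icc.coe_one, Set.Icc.coe_zero, add_zero, Set.projIcc_right]
      exact mk_one φ n a
    · have hs0 : 0 < (s : ℝ) := lt_of_le_of_ne s.2.1 fun h => hs (Subtype.ext h.symm)
      rw [pieceFlow, if_neg (by simpa using hs0)]
      simp)
  continuous_toFun := continuous_quot_lift _ (continuous_sigma fun n =>
    ContinuousMap.continuous_of_continuous_uncurry _ (continuous_pieceFlow φ n))

theorem flow_zero (z : Telescope φ) : flow φ z 0 = z := by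
  obtain ⟨n, a, t, rfl⟩ := exists_eq_mk z
  change pieceFlow φ n ((a, t), 0) = _
  rw [pieceFlow, if_pos (by simpa using t.2.2)]
  simp

theorem time_flow (z : Telescope φ) (s : unitInterval) :
    time φ (flow φ z s) = time φ z + s := by
  obtain ⟨n, a, t, rfl⟩ := exists_eq_mk z
  change time φ (pieceFlow φ n ((a, t), s)) = _
  have h0 := t.2.1
  have h1 := t.2.2
  have h2 := s.2.1
  have h3 := s.2.2
  rw [pieceFlow, time_mk]
  split_ifs with h
  · rw [Set.projIcc_of_mem _ ⟨by positivity, h⟩, time_mk]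
    simp only
    ring
  · simp only at h
    rw [Set.projIcc_of_mem _ ⟨by linarith, by linarith⟩, time_mk]
    push_cast
    ring

/-- The duration for which points have to flow to get closer to time `n`. -/
def delay (n : ℕ) : C(Telescope φ, unitInterval) :=
  ⟨fun z => Set.projIcc 0 1 zero_le_one (n - time φ z), continuous_projIcc.comp (by fun_prop)⟩

/-- The end of the deformation pushing the telescope towards time `n`. -/
def push (n : ℕ) : C(Telescope φ, Telescope φ) :=
  ⟨fun z => flow φ z (delay φ n z), by fun_prop⟩

/-- The deformation pushing the telescope towards time `n`. -/
def pushHomotopy (n : ℕ) : (ContinuousMap.id (Telescope φ)).Homotopy (push φ n) where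
  toFun q := flow φ q.2 (q.1 * delay φ n q.2)
  continuous_toFun := by fun_prop
  map_zero_left z := by
    rw [zero_mul]
    exact flow_zero φ z
  map_one_left z := by
    rw [one_mul]
    rfl

/-- Each push gains one unit of time or stops at `n`, so `k` pushes bring the times in `[n - k, n]`
to `n`. -/
theorem time_push {n : ℕ} {z : Telescope φ} (h : time φ z ≤ n) :
    time φ (push φ n z) = min (n : ℝ) (time φ z + 1) := by
  change time φ (flow φ z (delay φ n z)) = _
  rw [time_flow]
  change time φ z + ((Set.projIcc 0 1 zero_le_one (n - time φ z) : unitInterval) : ℝ) = _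
  rw [Set.coe_projIcc]
  rcases le_total (n - time φ z) 1 with h' | h'
  · rw [min_eq_right h', max_eq_right (by linarith), min_eq_left (by linarith)]
    ring
  · rw [min_eq_left h', max_eq_right zero_le_one, min_eq_right (by linarith)]

/-- The homotopy from the inclusion of `A n` to the inclusion of `A (n + 1)` composed with `φ n`. -/
def inclHomotopy (n : ℕ) : (incl φ n).Homotopy ((incl φ (n + 1)).comp (φ n)) where
  toFun q := mk φ n (q.2, q.1)
  continuous_toFun := by fun_prop
  map_zero_left _ := rfl
  map_one_left a := mk_one φ n a

/-- The cylinder over `A n` moves both loops along the same path of base points. -/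
theorem homotopic_incl_iff {N : Type*} [Fintype N] {n : ℕ} {a : A n} {p r : Ω^ N (A n) a} :
    GenLoop.Homotopic (mapLoop (incl φ n) rfl p) (mapLoop (incl φ n) rfl r) ↔
      GenLoop.Homotopic (mapLoop ((incl φ (n + 1)).comp (φ n)) rfl p)
        (mapLoop ((incl φ (n + 1)).comp (φ n)) rfl r) :=
  (homotopicAlong_of_homotopy (inclHomotopy φ n) rfl rfl ((inclHomotopy φ n).evalAt a)
    (fun _ => rfl) p).homotopic_iff
    (homotopicAlong_of_homotopy (inclHomotopy φ n) rfl rfl ((inclHomotopy φ n).evalAt a)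
      (fun _ => rfl) r)

end Telescope

/-- A zero-dimensional loop is a point. -/
def pointLoop {A : Type*} [TopologicalSpace A] (a z : A) : Ω^ Empty A a :=
  ⟨ContinuousMap.const _ z, fun _ ⟨i, _⟩ => i.elim⟩

/-- The zero-dimensional cube has empty boundary, so the base point imposes no condition. Statements
about loops of any dimension thereby cover path components. -/
theorem homotopic_pointLoop_iff {A : Type*} [TopologicalSpace A] {a z z' : A} :
    GenLoop.Homotopic (pointLoop a z) (pointLoop a z') ↔ Joined z z' := by
  constructor
  · rintro ⟨H⟩
    exact ⟨H.toHomotopy.evalAt isEmptyElim⟩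
  · rintro ⟨γ⟩
    exact homotopic_of_family (fun q => γ q.1) (by fun_prop) (fun _ => γ.source)
      (fun _ => γ.target) fun _ _ ⟨i, _⟩ => i.elim

theorem radialGlue_rel {N A : Type*} [Fintype N] {R : A → A → Prop} {k : ℝ}
    {G G' : (N → unitInterval) → A} {δ δ' : ℝ → A} (hG : ∀ z, R (G z) (G' z))
    (hδ : ∀ t, R (δ t) (δ' t)) (y : N → unitInterval) :
    R (radialGlue k G δ y) (radialGlue k G' δ' y) := by
  rw [radialGlue, radialGlue]
  split_ifs
  exacts [hG _, hδ _]

namespace SubdivisionTower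

variable {V : ℕ → Type u} {X : ∀ n, AbstractSimplicialComplex (V n)} {W : Type v}
  {Y : AbstractSimplicialComplex W}

/-! ### The map `Φ` -/

section Phi

variable {T : SubdivisionTower X}

theorem Phi_mk (n : ℕ) (a : T.mapSpace Y n) (t : unitInterval) :
    T.Phi Y (Telescope.mk (T.transition Y) n (a, t)) = T.piece Y n (a, t) := rfl

theorem Phi_incl (n : ℕ) (a : T.mapSpace Y n) :
    T.Phi Y (Telescope.incl (T.transition Y) n a) = T.compare Y n a :=
  T.piece_zero Y n a

theorem homotopic_incl_of_transitions {N : Type*} [Fintype N] {n : ℕ} {a : T.mapSpace Y n}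
    {p r : Ω^ N (T.mapSpace Y n) a} : ∀ j,
    GenLoop.Homotopic (mapLoop (T.transitions Y n j) rfl p)
      (mapLoop (T.transitions Y n j) rfl r) →
    GenLoop.Homotopic (mapLoop (Telescope.incl (T.transition Y) n) rfl p)
      (mapLoop (Telescope.incl (T.transition Y) n) rfl r) := by
  -- Including the loops back into the telescope at stage `n + j` permits induction on `j`, undoing
  -- one transition at a time.
  suffices ∀ j,
      GenLoop.Homotopic
        (mapLoop (Telescope.incl (T.transition Y) (n + j)) rfl (mapLoop (T.transitions Y n j) rfl p))
        (mapLoop (Telescope.incl (T.transition Y) (n + j)) rfl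
          (mapLoop (T.transitions Y n j) rfl r)) →
      GenLoop.Homotopic (mapLoop (Telescope.incl (T.transition Y) n) rfl p)
        (mapLoop (Telescope.incl (T.transition Y) n) rfl r) from
    fun j h => this j (homotopic_mapLoop _ rfl h)
  intro j
  induction j with
  | zero => exact id
  | succ j ih => exact fun h => ih ((Telescope.homotopic_incl_iff (T.transition Y)).2 h)

/-- Induction on the number of pushes needed. A push changes both loops by a free homotopy along the
same path, and so does its image under `Φ`, hence hypothesis and conclusion are equivalent to those
for the pushed loops. Once all times equal `n`, the loops lift to `A n`. -/
theorem homotopic_of_Phi_aux (hT : T.Fine) [CompactSpace (Realization (X 0))] {N : Type*}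
    [Fintype N] (n : ℕ) : ∀ (k : ℕ) {z : T.Tel Y} {p r : Ω^ N (T.Tel Y) z},
    (∀ x ∈ insert z (Set.range p ∪ Set.range r), (n : ℝ) - k ≤ Telescope.time (T.transition Y) x ∧
      Telescope.time (T.transition Y) x ≤ n) →
    GenLoop.Homotopic (mapLoop (T.Phi Y) rfl p) (mapLoop (T.Phi Y) rfl r) →
    GenLoop.Homotopic p r
  | 0, z, p, r, hk, h => by
    have ht : ∀ x ∈ insert z (Set.range p ∪ Set.range r),
        Telescope.time (T.transition Y) x = n := fun x hx =>
      le_antisymm (hk x hx).2 (by simpa using (hk x hx).1)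
    obtain ⟨a, rfl⟩ := Telescope.eq_incl_of_time _ (ht z (Set.mem_insert _ _))
    have hlift : ∀ p : Ω^ N (T.Tel Y) (Telescope.incl (T.transition Y) n a),
        (∀ y, Telescope.time (T.transition Y) (p y) = n) →
        ∃ p' : Ω^ N (T.mapSpace Y n) a,
          p = mapLoop (Telescope.incl (T.transition Y) n) rfl p' := by
      intro p hp
      obtain ⟨g, hg⟩ := Telescope.exists_lift (T.transition Y) p.1 hp
      refine ⟨⟨g, fun y hy => Telescope.incl_injective _ n ((hg y).trans (p.2 y hy))⟩,
        GenLoop.ext _ _ fun y => (hg y).symm⟩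
    obtain ⟨p', rfl⟩ := hlift p fun y => ht _ (Or.inr (Or.inl ⟨y, rfl⟩))
    obtain ⟨r', rfl⟩ := hlift r fun y => ht _ (Or.inr (Or.inr ⟨y, rfl⟩))
    have hmap : ∀ p : Ω^ N (T.mapSpace Y n) a,
        (mapLoop (T.Phi Y) rfl (mapLoop (Telescope.incl (T.transition Y) n) rfl p)).1 =
          (mapLoop (T.compare Y n) rfl p).1 := fun p =>
      ContinuousMap.ext fun y => Phi_incl n (p y)
    have h' : GenLoop.Homotopic (mapLoop (T.compare Y n) rfl p')
        (mapLoop (T.compare Y n) rfl r') := by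
      rw [GenLoop.Homotopic, hmap, hmap] at h
      exact h
    obtain ⟨j, hj⟩ := exists_homotopic_transitions hT h'
    exact homotopic_incl_of_transitions j hj
  | k + 1, z, p, r, hk, h => by
    let H := Telescope.pushHomotopy (T.transition Y) n
    have hA : ∀ p : Ω^ N (T.Tel Y) z,
        HomotopicAlong (H.evalAt z) p (mapLoop (Telescope.push (T.transition Y) n) rfl p) :=
      fun p => homotopicAlong_of_homotopy H rfl rfl (H.evalAt z) (fun _ => rfl) p
    have h' := (((hA p).map (T.Phi Y)).homotopic_iff ((hA r).map (T.Phi Y))).1 h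
    refine ((hA p).homotopic_iff (hA r)).2 (homotopic_of_Phi_aux hT n k ?_ h')
    have hpush : ∀ x, ((n : ℝ) - (k + 1 : ℕ) ≤ Telescope.time (T.transition Y) x ∧
        Telescope.time (T.transition Y) x ≤ n) →
        (n : ℝ) - k ≤ Telescope.time (T.transition Y) (Telescope.push (T.transition Y) n x) ∧
          Telescope.time (T.transition Y) (Telescope.push (T.transition Y) n x) ≤ n := by
      rintro x ⟨h1, h2⟩
      rw [Telescope.time_push _ h2]
      push_cast at h1
      refine ⟨le_min ?_ ?_, min_le_left _ _⟩
      · linarith [(Nat.cast_nonneg k : (0 : ℝ) ≤ k)]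
      · linarith
    rintro x (rfl | ⟨y, rfl⟩ | ⟨y, rfl⟩)
    · exact hpush z (hk z (Set.mem_insert _ _))
    · exact hpush (p y) (hk _ (Or.inr (Or.inl ⟨y, rfl⟩)))
    · exact hpush (r y) (hk _ (Or.inr (Or.inr ⟨y, rfl⟩)))

theorem homotopic_of_Phi (hT : T.Fine) [CompactSpace (Realization (X 0))] {N : Type*} [Fintype N]
    {z : T.Tel Y} {p r : Ω^ N (T.Tel Y) z}
    (h : GenLoop.Homotopic (mapLoop (T.Phi Y) rfl p) (mapLoop (T.Phi Y) rfl r)) :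
    GenLoop.Homotopic p r := by
  have hc : IsCompact (insert z (Set.range p ∪ Set.range r)) :=
    ((isCompact_range p.1.continuous).union (isCompact_range r.1.continuous)).insert z
  obtain ⟨c, hc⟩ := (hc.image (Telescope.time (T.transition Y)).continuous).bddAbove
  obtain ⟨n, hn⟩ := exists_nat_ge c
  refine homotopic_of_Phi_aux hT n n (fun x hx => ⟨?_, (hc ⟨x, hx, rfl⟩).trans hn⟩) h
  rw [sub_self]
  exact Telescope.time_nonneg _ x

/-- The path follows the telescope forwards. `Φ` stays subordinate to its starting value because
each linear homotopy remains in the simplices spanned by its start. -/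
theorem exists_path_incl (z : T.Tel Y) : ∃ m, ∀ n ≥ m, ∃ (a : T.mapSpace Y n)
    (γ : Path z (Telescope.incl (T.transition Y) n a)), T.Carried a (T.Phi Y z) ∧
      ∀ s, SupportLE (T.Phi Y (γ s)) (T.Phi Y z) := by
  obtain ⟨m, a, t, rfl⟩ := Telescope.exists_eq_mk z
  refine ⟨m + 1, fun n hn => ?_⟩
  induction n, hn using Nat.le_induction with
  | base =>
    let γ : Path (Telescope.mk (T.transition Y) m (a, t))
        (Telescope.incl (T.transition Y) (m + 1) (T.transition Y m a)) :=
      { toFun := fun s => Telescope.mk (T.transition Y) m (a, max t s)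
        continuous_toFun := (ContinuousMap.continuous _).comp (by fun_prop)
        source' := by rw [max_eq_left unitInterval.nonneg']
        target' := by
          rw [max_eq_right unitInterval.le_one']
          exact Telescope.mk_one _ m a }
    -- For `t < 1` the map given by `a` has positive weight in `Φ z`, so `a` is carried. At `t = 1`
    -- this weight vanishes, but the path is constant and its end is carried by definition.
    rcases eq_or_ne t 1 with rfl | ht
    · refine ⟨_, γ, ?_, fun s => ?_⟩
      · rw [Phi_mk, piece_one]
        exact SupportLE.refl _
      · change SupportLE (T.Phi Y (Telescope.mk (T.transition Y) m (a, max 1 s))) _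
        rw [max_eq_left unitInterval.le_one']
        exact SupportLE.refl _
    · have ha : T.Carried a (T.Phi Y (Telescope.mk (T.transition Y) m (a, t))) := by
        intro x w hw
        rw [mem_support_iff_pos] at hw ⊢
        let x' := (T.toBase m).homeo.symm x
        change 0 < (1 - (t : ℝ)) * (gamma (X m) Y a x').coord w +
          (t : ℝ) * (gamma (X m) Y a ((T.map m).real ((T.sub m).homeo.symm x'))).coord w
        have ht1 : (t : ℝ) < 1 := lt_of_le_of_ne t.2.2 fun h => ht (Subtype.ext h)
        exact add_pos_of_pos_of_nonneg (mul_pos (sub_pos.2 ht1) hw)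
          (mul_nonneg t.2.1 (Realization.nonneg _ _))
      exact ⟨_, γ, ha.transition, fun s => ha.piece _⟩
  | succ n _ ih =>
    obtain ⟨b, γ, hb, hγ⟩ := ih
    refine ⟨T.transition Y n b,
      γ.trans ((Telescope.inclHomotopy (T.transition Y) n).evalAt b), hb.transition, fun s => ?_⟩
    rw [Path.trans_apply]
    split_ifs
    exacts [hγ _, hb.piece _]

/-- A carried loop in `A n` is moved back to `z` along the path of `exists_path_incl`. On the inner
cube and on the collar alike, its image is subordinate to a shrunk copy of `r`, so the linear
homotopy applies. -/
theorem exists_homotopic_Phi (hT : T.Fine) [CompactSpace (Realization (X 0))] {N : Type*}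
    [Fintype N] (z : T.Tel Y) (r : Ω^ N C(Realization (X 0), Realization Y) (T.Phi Y z)) :
    ∃ p : Ω^ N (T.Tel Y) z, GenLoop.Homotopic (mapLoop (T.Phi Y) rfl p) r := by
  obtain ⟨n₀, h⟩ := exists_carried_loop hT r
  obtain ⟨m, hm⟩ := exists_path_incl z
  obtain ⟨a, γ, ha, hγ⟩ := hm (max n₀ m) (le_max_right _ _)
  obtain ⟨α, hα⟩ := h _ (le_max_left _ _) a ha
  -- One shrinking is required by `exists_carried_loop`; the second, below, matches the collar of
  -- `p`.
  let r' := transport (Path.refl (T.Phi Y z)) r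
  let p := transport γ.symm (mapLoop (Telescope.incl (T.transition Y) _) rfl α)
  refine ⟨p, (homotopic_of_supportLE (r := transport (Path.refl _) r') fun y => ?_).trans
    ((homotopic_shrink r').symm.trans (homotopic_shrink r).symm)⟩
  change SupportLE (T.Phi Y (p y)) _
  rw [map_transport, transport_apply]
  refine radialGlue_rel (fun y => ?_) (fun t => ?_) y
  · change SupportLE (T.Phi Y (Telescope.incl (T.transition Y) _ (α y))) _
    rw [Phi_incl]
    exact hα y
  · rw [Path.refl_extend]
    exact hγ _

theorem isWeakEquivalence_Phi (hT : T.Fine) [CompactSpace (Realization (X 0))] :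
    IsWeakEquivalence (T.Phi Y) := by
  refine ⟨⟨?_, ?_⟩, fun z q => ⟨?_, ?_⟩⟩
  · rintro ⟨z⟩ ⟨z'⟩ h
    have hj : Joined (T.Phi Y z) (T.Phi Y z') := Quotient.exact h
    have h' : GenLoop.Homotopic (mapLoop (T.Phi Y) rfl (pointLoop z z))
        (mapLoop (T.Phi Y) rfl (pointLoop z z')) :=
      homotopic_pointLoop_iff (a := T.Phi Y z).2 hj
    exact Quotient.sound (homotopic_pointLoop_iff.1 (homotopic_of_Phi hT h'))
  · rintro ⟨ψ⟩
    obtain ⟨n, hn⟩ := exists_carried_family hT (ContinuousMap.const Unit ψ)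
    obtain ⟨β, hβ⟩ := hn n le_rfl
    refine ⟨ZerothHomotopy.mk (Telescope.incl (T.transition Y) n (β ())), ?_⟩
    change ZerothHomotopy.mk (T.Phi Y _) = ZerothHomotopy.mk ψ
    rw [Phi_incl]
    have h : GenLoop.Homotopic (pointLoop ψ (T.compare Y n (β ()))) (pointLoop ψ ψ) :=
      homotopic_of_supportLE fun _ => hβ ()
    exact Quotient.sound (homotopic_pointLoop_iff.1 h)
  · rintro ⟨p⟩ ⟨r⟩ h
    exact Quotient.sound (homotopic_of_Phi hT (Quotient.exact h))
  · rintro ⟨r⟩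
    obtain ⟨p, hp⟩ := exists_homotopic_Phi hT z r
    exact ⟨Quotient.mk _ p, Quotient.sound hp⟩

end Phi

/-! ### The colimit of homotopy groups -/

section Colimit

variable {T : SubdivisionTower X} {g : SimplicialMap (X 0) Y}

theorem compare_basePoint (n : ℕ) (x : Realization (X 0)) :
    T.compare Y n (T.basePoint g n) x =
      gamma (X 0) Y (Realization.vertex _ g)
        ((T.mapToBase n).real ((T.toBase n).homeo.symm x)) := by
  rw [← gamma_pullback, real_vertex]
  rfl

theorem carried_basePoint : ∀ n, T.Carried (T.basePoint g n) g.real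
  | 0 => by
    intro x
    rw [compare_basePoint, gamma_vertex]
    change (g.real ((SimplicialMap.id (X 0)).real x)).coord.support ⊆ _
    have : (SimplicialMap.id (X 0)).real x = x := Realization.ext Finsupp.mapDomain_id
    rw [this]
  | n + 1 => by
    rw [← transition_basePoint]
    exact (carried_basePoint n).transition

theorem basePath_apply (n : ℕ) (s : unitInterval) (x : Realization (X 0)) :
    T.basePath g n s x = mix (T.compare Y n (T.basePoint g n) x) (g.real x) s := by
  refine eq_of_coord fun w => ?_
  rw [mix_coord_apply (Or.inr (SupportLE.compatible (carried_basePoint n) x)), compare_basePoint]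
  change (1 - ((unitInterval.symm s : unitInterval) : ℝ)) *
      (gamma (X 0) Y (Realization.vertex _ g) x).coord w +
    ((unitInterval.symm s : unitInterval) : ℝ) * _ = _
  rw [gamma_vertex, unitInterval.coe_symm_eq, sub_sub_cancel, add_comm]

/-- For `s ≠ 0` the point `|g| x` has positive weight on the earlier path, and every approximation
of `|g|` has its support inside that of `|g| x`. The collars of consecutive comparison loops are
therefore joined by segments, with no separate correction of base points. -/
theorem basePath_supportLE (n : ℕ) (s : unitInterval) :
    SupportLE (T.basePath g (n + 1) s) (T.basePath g n s) := by
  rcases eq_or_ne s 0 with rfl | hs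
  · rw [Path.source, Path.source, ← transition_basePoint]
    exact Carried.transition (SupportLE.refl _)
  · intro x w hw
    rw [basePath_apply] at hw ⊢
    have hg : w ∈ (g.real x).coord.support := by
      rcases mem_support_mix hw with h | h
      exacts [carried_basePoint _ x h, h.2]
    rw [mem_support_iff_pos] at hg ⊢
    rw [mix_coord_apply (Or.inr (SupportLE.compatible (carried_basePoint n) x))]
    have hs0 : 0 < (s : ℝ) := lt_of_le_of_ne s.2.1 fun h => hs (Subtype.ext h.symm)
    exact add_pos_of_nonneg_of_pos
      (mul_nonneg (sub_nonneg.2 s.2.2) (Realization.nonneg _ _)) (mul_pos hs0 hg)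

/-- The loop at `|g|` obtained from a loop in a mapping complex. -/
def comparisonLoop (T : SubdivisionTower X) (g : SimplicialMap (X 0) Y) {N : Type*} [Fintype N]
    (n : ℕ) (p : Ω^ N (T.mapSpace Y n) (T.basePoint g n)) :
    Ω^ N C(Realization (X 0), Realization Y) g.real :=
  transport (T.basePath g n) (mapLoop (T.compare Y n) rfl p)

theorem transitions_basePoint (n : ℕ) : ∀ j,
    T.transitions Y n j (T.basePoint g n) = T.basePoint g (n + j)
  | 0 => rfl
  | j + 1 => (congrArg (T.transition Y (n + j)) (transitions_basePoint n j)).trans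
      (T.transition_basePoint g (n + j))

theorem PiColim.mk_transitions (q n : ℕ) (p : Ω^ (Fin q) (T.mapSpace Y n) (T.basePoint g n)) :
    ∀ j, PiColim.mk T g q n p = PiColim.mk T g q (n + j)
      (mapLoop (T.transitions Y n j) (transitions_basePoint n j) p)
  | 0 => rfl
  | j + 1 => (PiColim.mk_transitions q n p j).trans (Quot.sound (PiColim.Rel.glue (n + j) _))

/-- Representatives are provided at all later levels so that two classes can be compared at a common
one. -/
theorem PiColim.exists_mk (q : ℕ) (c : PiColim T g q) : ∃ n, ∀ m ≥ n,
    ∃ p : Ω^ (Fin q) (T.mapSpace Y m) (T.basePoint g m), c = PiColim.mk T g q m p := by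
  obtain ⟨⟨n, ⟨p⟩⟩, rfl⟩ := Quot.exists_rep c
  refine ⟨n, fun m hm => ?_⟩
  obtain ⟨j, rfl⟩ := Nat.exists_eq_add_of_le hm
  exact ⟨_, PiColim.mk_transitions q n p j⟩

variable [CompactSpace (Realization (X 0))]

theorem comparisonLoop_transition {N : Type*} [Fintype N] (n : ℕ)
    (p : Ω^ N (T.mapSpace Y n) (T.basePoint g n)) :
    GenLoop.Homotopic (comparisonLoop T g n p) (comparisonLoop T g (n + 1)
      (mapLoop (T.transition Y n) (T.transition_basePoint g n) p)) := by
  refine (homotopic_of_supportLE fun y => ?_).symm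
  exact radialGlue_rel (R := SupportLE)
    (fun z => Carried.transition (SupportLE.refl (T.compare Y n (p z))))
    (fun t => basePath_supportLE n _) y

/-- The comparison map on the colimit of homotopy groups. -/
def comparison (T : SubdivisionTower X) (g : SimplicialMap (X 0) Y) (q : ℕ) :
    PiColim T g q → π_ q C(Realization (X 0), Realization Y) g.real :=
  Quot.lift
    (fun c => Quotient.map (comparisonLoop T g c.1)
      (fun p r h => (homotopicAlong_transport _ _).homotopic_iff
        (homotopicAlong_transport _ _) |>.1 (homotopic_mapLoop _ rfl h)) c.2) (by
    rintro _ _ ⟨n, ⟨p⟩⟩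
    exact Quotient.sound (comparisonLoop_transition n p))

theorem isComparison_comparison (q : ℕ) : T.IsComparison g q (comparison T g q) := fun _ _ _ =>
  Quotient.eq.trans homotopicAlong_iff.symm

theorem comparison_bijective (hT : T.Fine) (q : ℕ) :
    Function.Bijective (comparison T g q) := by
  constructor
  · intro c c' h
    obtain ⟨n, hn⟩ := PiColim.exists_mk q c
    obtain ⟨n', hn'⟩ := PiColim.exists_mk q c'
    obtain ⟨p, rfl⟩ := hn (max n n') (le_max_left _ _)
    obtain ⟨p', rfl⟩ := hn' (max n n') (le_max_right _ _)
    have h' := ((homotopicAlong_transport _ _).homotopic_iff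
      (homotopicAlong_transport _ _)).2 (Quotient.exact h)
    obtain ⟨j, hj⟩ := exists_homotopic_transitions hT h'
    rw [PiColim.mk_transitions _ _ _ j, PiColim.mk_transitions _ _ p' j]
    exact congrArg (fun c => Quot.mk (PiColim.Rel T g q) ⟨_, c⟩) (Quotient.sound hj)
  · rintro ⟨r⟩
    obtain ⟨n, hn⟩ := exists_carried_loop hT r
    obtain ⟨α, hα⟩ := hn n le_rfl (T.basePoint g n) (carried_basePoint n)
    refine ⟨PiColim.mk T g q n α, ?_⟩
    have hr : GenLoop.Homotopic (transport (Path.refl _) r) r := (homotopic_shrink r).symm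
    refine Eq.trans ((isComparison_comparison q n α _).2 ?_) (Quotient.sound hr)
    -- On the boundary this linear homotopy runs from the image of the base point to `|g|`, which is
    -- exactly `basePath`. It therefore exhibits the required change of base point.
    obtain ⟨H, hH⟩ := exists_linear_homotopy (mapLoop (T.compare Y n) rfl α).1
      (transport (Path.refl g.real) r).1 hα
    refine ⟨H, fun y => ?_, fun y => ?_, fun s y hy => ?_⟩
    · exact ContinuousMap.ext fun x => (hH 0 y x).trans (mix_zero _ _)
    · exact ContinuousMap.ext fun x => (hH 1 y x).trans (mix_one (SupportLE.compatible (hα y) x))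
    · refine ContinuousMap.ext fun x => (hH s y x).trans ?_
      rw [basePath_apply, (mapLoop (T.compare Y n) rfl α).2 y hy,
        (transport (Path.refl g.real) r).2 y hy]

end Colimit

end SubdivisionTower

end ContiguityComplex

end

/-! ### The theorem, with the third statement obtained from the shifted towers. -/

theorem theorem7p3 {V : ℕ → Type u} (X : ∀ n, AbstractSimplicialComplex (V n)) [Finite (V 0)]
    (T : ContiguityComplex.SubdivisionTower X)
    (hmesh : Filter.Tendsto (fun n => (T.toBase n).mesh) Filter.atTop (𝓝 0))
    {W : Type v} (Y : AbstractSimplicialComplex W) :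
    ContiguityComplex.IsWeakEquivalence (T.Phi Y) ∧
    Function.Bijective (ContiguityComplex.pi0Map (T.Phi Y)) ∧
    ∀ (k : ℕ) (g : ContiguityComplex.SimplicialMap (X k) Y) (q : ℕ), 1 ≤ q →
      ∃ θ : ContiguityComplex.SubdivisionTower.PiColim (T.shift k) g q →
          π_ q C(ContiguityComplex.Realization (X k), ContiguityComplex.Realization Y) g.real,
        (T.shift k).IsComparison g q θ ∧ Function.Bijective θ := by
  have hT : T.Fine := T.fine_of_mesh hmesh
  have hc : CompactSpace (ContiguityComplex.Realization (X 0)) :=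
    ContiguityComplex.compactSpace_of_finite
  have hΦ := ContiguityComplex.SubdivisionTower.isWeakEquivalence_Phi (Y := Y) hT
  refine ⟨hΦ, hΦ.1, fun k g q _ => ?_⟩
  -- The bottom of the shifted tower is `X k` by definition; finiteness of `V 0` enters here only
  -- through compactness.
  have hk : CompactSpace (ContiguityComplex.Realization ((fun m => X (k + m)) 0)) :=
    T.compactSpace_level k
  exact ⟨ContiguityComplex.SubdivisionTower.comparison (T.shift k) g q,
    ContiguityComplex.SubdivisionTower.isComparison_comparison q,
    ContiguityComplex.SubdivisionTower.comparison_bijective (hT.shift k) q⟩
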